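/- Let $K$ be a field. For a finite simple graph $G$ with vertex set $V(G)$ let $S_G=K[x_v,y_v : v\in V(G)]$ with the standard grading, and let $J_G\subset S_G$ be its binomial edge ideal, generated by all $x_iy_j-x_jy_i$ with $\{i,j\}\in E(G)$. Write $\beta_{i,m}=\dim_K \operatorname{Tor}_i^{S_G}(S_G/J_G,K)_m$ for the graded Betti numbers of $S_G/J_G$, let $p$ be the projective dimension of $S_G/J_G$ (the largest $i$ with $\beta_{i,m}\neq 0$ for some $m$) and $r$ its regularity (the largest $j$ with $\beta_{i,i+j}\ne 0$ for some $i$). The Cohen–Macaulay type is $\text{CM-type}(S_G/J_G)=\sum_{j=0}^{r}\beta_{p,p+j}$. A Betti number $\beta_{i,i+j}\neq 0$ is called extremal if $\beta_{k,k+\ell}=0$ for all $(k,\ell)\ne(i,j)$ with $k\ge i$ and $\ell\ge j$. If there is exactly one pair $(i,j)$ for which $\beta_{i,i+j}$ is extremal, then $S_G/J_G$ is said to have a unique extremal Betti number, and $\widehat\beta(S_G/J_G)$ denotes the value of $\beta_{i,i+j}$ at this pair. Lemma. Let $H_1$ and $H_2$ be finite connected simple graphs on disjoint vertex sets such that $S_{H_1}/J_{H_1}$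 and $S_{H_2}/J_{H_2}$ are Cohen–Macaulay, and let $G=H_1\sqcup H_2$ be their disjoint union. Then (i) $\text{CM-type}(S_G/J_G)=\text{CM-type}(S_{H_1}/J_{H_1})\cdot\text{CM-type}(S_{H_2}/J_{H_2})$; (ii) each of $S_{H_1}/J_{H_1}$, $S_{H_2}/J_{H_2}$ and $S_G/J_G$ has a unique extremal Betti number, and $\widehat\beta(S_G/J_G)=\widehat\beta(S_{H_1}/J_{H_1})\cdot\widehat\beta(S_{H_2}/J_{H_2})$. -/

import Mathlib

open MvPolynomial

noncomputable section

/-- The variables of the polynomial ring attached to a vertex set `V`: `Sum.inl v` stands for `x_v`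
and `Sum.inr v` stands for `y_v`. -/
abbrev EdgeVar (V : Type*) : Type _ := V ⊕ V

/-- The binomial edge ideal `J_G = (x_i y_j - x_j y_i : {i, j} ∈ E(G))` in
`K[x_v, y_v : v ∈ V]`. -/
def binomialEdgeIdeal (K : Type*) [Field K] {V : Type*} (G : SimpleGraph V) :
    Ideal (MvPolynomial (EdgeVar V) K) :=
  Ideal.span {f | ∃ i j : V, G.Adj i j ∧
    f = X (Sum.inl i) * X (Sum.inr j) - X (Sum.inl j) * X (Sum.inr i)}

namespace GradedBetti

variable {K : Type*} [Field K] {σ : Type*}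

/-- The image in `S / J` of the irrelevant maximal ideal, generated by all variables, of
`S = K[x_v : v ∈ σ]`. -/
def irrelevantIdeal (J : Ideal (MvPolynomial σ K)) : Ideal (MvPolynomial σ K ⧸ J) :=
  (Ideal.span (Set.range (X : σ → MvPolynomial σ K))).map (Ideal.Quotient.mk J)

/-- The standard graded algebra `S / J` is Cohen-Macaulay: its depth equals its Krull dimension,
that is, the irrelevant maximal ideal contains a regular sequence on `S / J` whose length is
`dim S / J` (no regular sequence in that ideal is longer). -/
def IsCohenMacaulay (J : Ideal (MvPolynomial σ K)) : Prop :=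
  ∃ rs : List (MvPolynomial σ K ⧸ J),
    (∀ r ∈ rs, r ∈ irrelevantIdeal J) ∧
    RingTheory.Sequence.IsRegular (MvPolynomial σ K ⧸ J) rs ∧
    (rs.length : WithBot ℕ∞) = ringKrullDim (MvPolynomial σ K ⧸ J)

/-- The component of degree `j` of the graded module `S / J`, for a homogeneous ideal `J`. -/
def degreePart (J : Ideal (MvPolynomial σ K)) (j : ℕ) : Submodule K (MvPolynomial σ K ⧸ J) :=
  (homogeneousSubmodule σ K j).map (Ideal.Quotient.mkₐ K J).toLinearMap

open Classical in
/-- The sign of `e_v` in front of `e_B` in the exterior algebra: `(-1)` to the number of elements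
of `B` that come before `v`, in a fixed auxiliary linear order of the variables (the Koszul
complexes for two orders are isomorphic). -/
def koszulSign (v : σ) (B : Finset σ) : ℤ :=
  (-1) ^ (B.filter fun u => WellOrderingRel u v).card

open Classical in
theorem koszulSign_insert [DecidableEq σ] (u v : σ) (B : Finset σ) (hv : v ∉ B) :
    koszulSign u (insert v B) = (if WellOrderingRel v u then -1 else 1) * koszulSign u B := by
  unfold koszulSign
  have e : (insert v B).filter (fun w => WellOrderingRel w u)
      = if WellOrderingRel v u then insert v (B.filter fun w => WellOrderingRel w u)
        else B.filter fun w => WellOrderingRel w u := by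
    ext w; by_cases h : WellOrderingRel v u <;> simp [h] <;> grind
  by_cases h : WellOrderingRel v u
  · rw [e, if_pos h, if_pos h, Finset.card_insert_of_notMem (by simp [hv]), pow_succ]; ring
  · rw [e, if_neg h, if_neg h, one_mul]

variable [Fintype σ] [DecidableEq σ]

/-- The differential of the Koszul complex `K(x; S / J) = S / J ⊗ ⋀ K^σ` of all the variables.
An element `∑ f A ⊗ e_A` of the complex is given by its coefficients `f A`, where `A` runs through
the finite sets of variables and `e_A` is the ordered wedge product of the `e_v`, `v ∈ A`;
the differential takes `e_A` to `∑ v ∈ A, ± x_v e_{A \ {v}}`, so that the coefficient of `e_B`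
in the boundary of `f` is `∑ v ∉ B, ± x_v f (B ∪ {v})`. -/
def koszulD (J : Ideal (MvPolynomial σ K)) :
    (Finset σ → MvPolynomial σ K ⧸ J) →ₗ[K] (Finset σ → MvPolynomial σ K ⧸ J) where
  toFun f B := ∑ v ∈ Bᶜ, koszulSign v B • (Ideal.Quotient.mk J (X v) * f (insert v B))
  map_add' f g := by
    funext B
    simp [mul_add, Finset.sum_add_distrib]
  map_smul' c f := by
    funext B
    simp only [Pi.smul_apply, RingHom.id_apply, Finset.smul_sum, mul_smul_comm]
    exact Finset.sum_congr rfl fun v _ => smul_comm _ _ _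

/-- The Koszul chains of homological degree `i` and internal degree `m`, where `e_A` has internal
degree `#A`. -/
def koszulChains (J : Ideal (MvPolynomial σ K)) (i m : ℕ) :
    Submodule K (Finset σ → MvPolynomial σ K ⧸ J) :=
  Submodule.pi Set.univ fun A =>
    if A.card = i ∧ i ≤ m then degreePart J (m - i) else ⊥

/-- The Koszul cycles of homological degree `i` and internal degree `m`. -/
def koszulCycles (J : Ideal (MvPolynomial σ K)) (i m : ℕ) :
    Submodule K (Finset σ → MvPolynomial σ K ⧸ J) :=
  koszulChains J i m ⊓ LinearMap.ker (koszulD J)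

/-- The Koszul boundaries of homological degree `i` and internal degree `m`. -/
def koszulBoundaries (J : Ideal (MvPolynomial σ K)) (i m : ℕ) :
    Submodule K (Finset σ → MvPolynomial σ K ⧸ J) :=
  (koszulChains J (i + 1) m).map (koszulD J)

/-- The Koszul differential squares to zero. -/
theorem koszulD_koszulD (J : Ideal (MvPolynomial σ K)) (f : Finset σ → MvPolynomial σ K ⧸ J) :
    koszulD J (koszulD J f) = 0 := by
  classical
  funext B
  simp only [koszulD, LinearMap.coe_mk, AddHom.coe_mk, Pi.zero_apply, Finset.mul_sum,
    Finset.smul_sum]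
  rw [Finset.sum_sigma']
  refine Finset.sum_involution (fun q _ => ⟨q.2, q.1⟩) ?_ ?_ ?_ ?_
  · rintro ⟨v, u⟩ h
    simp only [Finset.mem_sigma, Finset.mem_compl, Finset.mem_insert, not_or] at h
    obtain ⟨hv, huv, hu⟩ := h
    dsimp only
    rw [koszulSign_insert u v B hv, koszulSign_insert v u B hu, Finset.insert_comm]
    have := @trichotomous σ WellOrderingRel _ u v
    have hasym : WellOrderingRel u v → ¬ WellOrderingRel v u := fun h => asymm h
    by_cases h1 : WellOrderingRel u v
    · simp only [h1, hasym h1, if_true, if_false, zsmul_eq_mul]; push_cast; ring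
    · have h2 : WellOrderingRel v u := by tauto
      simp only [h1, h2, if_true, if_false, zsmul_eq_mul]; push_cast; ring
  · rintro ⟨v, u⟩ h _ h'
    simp only [Finset.mem_sigma, Finset.mem_compl, Finset.mem_insert, not_or] at h
    simp only [Sigma.mk.injEq] at h'
    exact h.2.1 h'.1
  · rintro ⟨v, u⟩ h
    simp only [Finset.mem_sigma, Finset.mem_compl, Finset.mem_insert, not_or] at h ⊢
    tauto
  · rintro ⟨v, u⟩ h; rfl

/-- The Koszul differential preserves the internal degree. -/
theorem koszulD_mem (J : Ideal (MvPolynomial σ K)) (i m : ℕ)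
    (f : Finset σ → MvPolynomial σ K ⧸ J) (hf : f ∈ koszulChains J (i + 1) m) :
    koszulD J f ∈ koszulChains J i m := by
  have key : ∀ j (v : σ) x, x ∈ degreePart J j →
      Ideal.Quotient.mk J (X v) * x ∈ degreePart J (j+1) := by
    rintro j v _ ⟨p, hp, rfl⟩
    refine ⟨X v * p, ?_, by simp⟩
    have := (isHomogeneous_X K v).mul ((mem_homogeneousSubmodule _ _).1 hp)
    rw [add_comm] at this
    exact this
  simp only [koszulChains, Submodule.mem_pi, Set.mem_univ, true_implies] at hf ⊢
  intro B
  refine Submodule.sum_mem _ fun v hv => zsmul_mem ?_ _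
  have h := hf (insert v B)
  rw [Finset.mem_compl] at hv
  rw [Finset.card_insert_of_notMem hv] at h
  by_cases hc : B.card = i
  · by_cases hm : i + 1 ≤ m
    · rw [if_pos ⟨by omega, hm⟩] at h
      rw [if_pos ⟨hc, by omega⟩, show m - i = m - (i+1) + 1 by omega]
      exact key _ _ _ h
    · rw [if_neg (by tauto)] at h
      rw [(Submodule.mem_bot K).1 h]; simp
  · rw [if_neg (by omega)] at h
    rw [(Submodule.mem_bot K).1 h]; simp
/-- Boundaries are cycles. -/
theorem koszulBoundaries_le (J : Ideal (MvPolynomial σ K)) (i m : ℕ) :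
    koszulBoundaries J i m ≤ koszulCycles J i m := by
  rintro _ ⟨f, hf, rfl⟩
  exact ⟨koszulD_mem J i m f hf, koszulD_koszulD J f⟩

/-- The graded Betti number `β_{i,m}(S / J) = dim_K Tor_i^S(S / J, K)_m` of a homogeneous ideal
`J`, the graded Tor being computed from the Koszul resolution of `K`: it is the homology of the
Koszul complex `K(x; S / J)` in homological degree `i` and internal degree `m`. -/
def betti (J : Ideal (MvPolynomial σ K)) (i m : ℕ) : ℕ :=
  Module.finrank K
    (koszulCycles J i m ⧸ (koszulBoundaries J i m).submoduleOf (koszulCycles J i m))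

/-- The projective dimension of `S / J`, that is the length of its minimal graded free resolution:
the largest `i` with `β_{i,m} ≠ 0` for some `m`. -/
def projDim (J : Ideal (MvPolynomial σ K)) : ℕ :=
  sSup {i | ∃ m, betti J i m ≠ 0}

/-- The Castelnuovo-Mumford regularity of `S / J`: the largest `j` with `β_{i,i+j} ≠ 0` for
some `i`. -/
def reg (J : Ideal (MvPolynomial σ K)) : ℕ :=
  sSup {j | ∃ i, betti J i (i + j) ≠ 0}

/-- The Cohen-Macaulay type of `S / J`: the sum of the `β_{p,p+j}`, `0 ≤ j ≤ r`, where `p` is the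
projective dimension and `r` the regularity. -/
def cmType (J : Ideal (MvPolynomial σ K)) : ℕ :=
  ∑ j ∈ Finset.range (reg J + 1), betti J (projDim J) (projDim J + j)

/-- The Betti number `β_{i,i+j}(S / J)` is extremal. -/
def IsExtremal (J : Ideal (MvPolynomial σ K)) (i j : ℕ) : Prop :=
  betti J i (i + j) ≠ 0 ∧
    ∀ k l : ℕ, (k, l) ≠ (i, j) → i ≤ k → j ≤ l → betti J k (k + l) = 0

/-- `S / J` has a unique extremal Betti number. -/
def HasUniqueExtremal (J : Ideal (MvPolynomial σ K)) : Prop :=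
  ∃! q : ℕ × ℕ, IsExtremal J q.1 q.2

open Classical in
/-- The unique extremal Betti number of `S / J` (and `0` if there is not exactly one). -/
def uniqueExtremal (J : Ideal (MvPolynomial σ K)) : ℕ :=
  if h : HasUniqueExtremal J then betti J h.choose.1 (h.choose.1 + h.choose.2) else 0

end GradedBetti

end

/-!
Both claims follow from a comparison of the two Cohen-Macaulay algebras with Artinian ones.

Let `R = S / J` be a Cohen-Macaulay standard graded algebra in `n` variables. Its Betti numbers are
the dimensions of the Koszul homology of `R`. If `θ` is a homogeneous nonzerodivisor of degree
`e > 0`, then multiplication by `θ` is null-homotopic on the Koszul complex, because `θ` is a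
combination of the variables; hence `H_i(R)_m` embeds into `H_{i+1}(R / θ)_{m+e}`, and it is
isomorphic to it if `H_{i+1}(R)_{m+e} = 0` (`RegularStep.isExactAt_of_quotient`,
`RegularStep.finrank_gradedHomology_eq`). The embedding is induced by the homotopy itself, so no
long exact sequence is needed.

The same two facts without internal degrees show that depth is visible in the Koszul homology:
`H_i(R) = 0` for `i > n - k` if the irrelevant ideal contains a regular sequence of length `k`,
homogeneous or not (`hasKoszulDepth_of_isWeaklyRegular`). As long as such a `k` is positive, the
socle of `R` vanishes and there is a homogeneous nonzerodivisor of positive degree, by prime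
avoidance for the homogeneous cores of the associated primes
(`exists_isHomogeneous_isSMulRegular`). Passing to the quotient lowers both `k` and the dimension.
Since the depth of `R` is its dimension, the procedure ends with an algebra `S / A` of dimension
zero, in which all the variables are nilpotent (`exists_regularReduction`).

If `c` elements of total degree `E` have been used, then `H_{n-c}(R)_m` is isomorphic to
`H_n(S / A)_{m+E}`, which is a graded component of the socle of `S / A`, and the Betti table of `R`
is contained in the rectangle whose corner corresponds to the highest nonzero component of `S / A`
(`RegularReduction.exists_hasCorner`). Therefore `R` has a unique extremal Betti number, the
dimension of this component, and the Cohen-Macaulay type of `R` is the dimension of the socle of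
`S / A`.

For a disjoint union of graphs the algebra is a tensor product over `K` (`tensorEquiv`). Over a
field, reductions `A₁` and `A₂` of the two factors combine to a reduction of the tensor product
(`RegularReduction.disjointSum`), whose socle and whose highest component are the tensor products
of those of `S₁ / A₁` and `S₂ / A₂` (`finrank_socle_disjointSum`,
`finrank_degreePart_disjointSum`).
-/

noncomputable section

namespace GradedBetti

set_option linter.unusedSectionVars false

/-! ### Koszul homology of a module with a graded family of submodules -/

section Koszul

variable (K : Type*) {R σ M N : Type*} [Field K] [CommRing R] [Algebra K R]
  [Fintype σ] [DecidableEq σ]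
  [AddCommGroup M] [Module K M] [Module R M] [IsScalarTower K R M]
  [AddCommGroup N] [Module K N] [Module R N] [IsScalarTower K R N]

/-- The differential of the Koszul complex `M ⊗ ⋀ K^σ` of the family `x`, in the same coordinates
and with the same signs as `koszulD`. -/
def moduleKoszulD (x : σ → R) : (Finset σ → M) →ₗ[K] (Finset σ → M) where
  toFun f B := ∑ v ∈ Bᶜ, koszulSign v B • (x v • f (insert v B))
  map_add' f g := by
    funext B
    simp [Finset.sum_add_distrib]
  map_smul' c f := by
    funext B
    simp only [Pi.smul_apply, RingHom.id_apply, Finset.smul_sum]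
    refine Finset.sum_congr rfl fun v _ => ?_
    rw [smul_comm (x v) c, smul_comm _ c]

/-- Exterior multiplication by `∑ a v e_v` on the Koszul complex. -/
def koszulWedge (a : σ → R) : (Finset σ → M) →ₗ[K] (Finset σ → M) where
  toFun f A := ∑ v ∈ A, koszulSign v (A.erase v) • (a v • f (A.erase v))
  map_add' f g := by
    funext B
    simp [Finset.sum_add_distrib]
  map_smul' c f := by
    funext B
    simp only [Pi.smul_apply, RingHom.id_apply, Finset.smul_sum]
    refine Finset.sum_congr rfl fun v _ => ?_
    rw [smul_comm (a v) c, smul_comm _ c]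

theorem moduleKoszulD_apply (x : σ → R) (f : Finset σ → M) (B : Finset σ) :
    moduleKoszulD K x f B = ∑ v ∈ Bᶜ, koszulSign v B • (x v • f (insert v B)) := rfl

theorem koszulWedge_apply (a : σ → R) (f : Finset σ → M) (A : Finset σ) :
    koszulWedge K a f A = ∑ v ∈ A, koszulSign v (A.erase v) • (a v • f (A.erase v)) := rfl


theorem koszulSign_mul_self (v : σ) (B : Finset σ) : koszulSign v B * koszulSign v B = 1 := by
  unfold koszulSign
  rw [← mul_pow]; simp

/-- The two orders in which `u` and `v` can be added to a set give opposite signs. -/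
theorem koszulSign_mul_insert {u v : σ} (huv : u ≠ v) {B : Finset σ} (hu : u ∉ B) (hv : v ∉ B) :
    koszulSign v (insert u B) * koszulSign u (insert v B)
      = -(koszulSign u B * koszulSign v B) := by
  rw [koszulSign_insert v u B hu, koszulSign_insert u v B hv]
  have := @trichotomous σ WellOrderingRel _ u v
  have hasym : WellOrderingRel u v → ¬ WellOrderingRel v u := fun h => asymm h
  by_cases h1 : WellOrderingRel u v
  · simp only [h1, hasym h1, if_true, if_false]; ring
  · have h2 : WellOrderingRel v u := by tauto
    simp only [h1, h2, if_true, if_false]; ring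

theorem koszulSign_mul_koszulSign_insert {u v : σ} (huv : u ≠ v) {B : Finset σ} (hu : u ∉ B)
    (hv : v ∉ B) :
    koszulSign v B * koszulSign u (insert v B) = -(koszulSign u B * koszulSign v (insert u B)) := by
  rw [koszulSign_insert v u B hu, koszulSign_insert u v B hv]
  have := @trichotomous σ WellOrderingRel _ u v
  have hasym : WellOrderingRel u v → ¬ WellOrderingRel v u := fun h => asymm h
  by_cases h1 : WellOrderingRel u v
  · simp only [h1, hasym h1, if_true, if_false]; ring
  · have h2 : WellOrderingRel v u := by tauto
    simp only [h1, h2, if_true, if_false]; ring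

theorem moduleKoszulD_moduleKoszulD (x : σ → R) (f : Finset σ → M) :
    moduleKoszulD K x (moduleKoszulD K x f) = 0 := by
  funext B
  simp only [moduleKoszulD_apply, Pi.zero_apply, Finset.smul_sum]
  rw [Finset.sum_sigma']
  refine Finset.sum_involution (fun q _ => ⟨q.2, q.1⟩) ?_ ?_ ?_ ?_
  · rintro ⟨v, u⟩ h
    simp only [Finset.mem_sigma, Finset.mem_compl, Finset.mem_insert, not_or] at h
    obtain ⟨hv, huv, hu⟩ := h
    dsimp only
    rw [Finset.insert_comm v u B, smul_comm (x v) (koszulSign u _),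
      smul_comm (x u) (koszulSign v _), smul_comm (x v) (x u), smul_smul, smul_smul,
      koszulSign_mul_koszulSign_insert huv hu hv, neg_smul,
      smul_smul (koszulSign u B), neg_add_cancel]
  · rintro ⟨v, u⟩ h _ h'
    simp only [Finset.mem_sigma, Finset.mem_compl, Finset.mem_insert, not_or] at h
    simp only [Sigma.mk.injEq] at h'
    exact h.2.1 h'.1
  · rintro ⟨v, u⟩ h
    simp only [Finset.mem_sigma, Finset.mem_compl, Finset.mem_insert, not_or] at h ⊢
    tauto
  · rintro ⟨v, u⟩ h; rfl

/-- Multiplication by `∑ a v * x v` is null-homotopic on the Koszul complex of `x`. -/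
theorem moduleKoszulD_koszulWedge (x a : σ → R) (f : Finset σ → M) :
    moduleKoszulD K x (koszulWedge K a f) + koszulWedge K a (moduleKoszulD K x f)
      = (∑ v, a v * x v) • f := by
  funext B
  simp only [Pi.add_apply, Pi.smul_apply, moduleKoszulD_apply, koszulWedge_apply]
  have e1 : ∑ v ∈ Bᶜ, koszulSign v B • (x v • ∑ u ∈ insert v B,
        koszulSign u ((insert v B).erase u) • (a u • f ((insert v B).erase u)))
      = ∑ v ∈ Bᶜ, (a v * x v) • f B
        - ∑ v ∈ Bᶜ, ∑ u ∈ B, (koszulSign u (B.erase u) * koszulSign v (B.erase u)) •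
            ((a u * x v) • f (insert v (B.erase u))) := by
    rw [← Finset.sum_sub_distrib]
    refine Finset.sum_congr rfl fun v hv => ?_
    rw [Finset.mem_compl] at hv
    rw [Finset.sum_insert hv, Finset.erase_insert hv, smul_add, smul_add, sub_eq_add_neg,
      ← Finset.sum_neg_distrib, Finset.smul_sum, Finset.smul_sum]
    congr 1
    · rw [smul_comm (x v) (koszulSign v B), smul_smul, koszulSign_mul_self, one_smul, smul_smul,
        mul_comm]
    · refine Finset.sum_congr rfl fun u hu => ?_
      have huv : u ≠ v := by rintro rfl; exact hv hu
      have hv' : v ∉ B.erase u := fun h => hv (Finset.mem_of_mem_erase h)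
      rw [Finset.erase_insert_of_ne huv.symm, smul_comm (x v) (koszulSign u _), smul_smul,
        smul_smul, mul_comm (x v), ← neg_smul,
        ← koszulSign_mul_insert huv (Finset.notMem_erase u B) hv', Finset.insert_erase hu]
  have e2 : ∑ u ∈ B, koszulSign u (B.erase u) • (a u • ∑ v ∈ (B.erase u)ᶜ,
        koszulSign v (B.erase u) • (x v • f (insert v (B.erase u))))
      = ∑ u ∈ B, (a u * x u) • f B
        + ∑ v ∈ Bᶜ, ∑ u ∈ B, (koszulSign u (B.erase u) * koszulSign v (B.erase u)) •
            ((a u * x v) • f (insert v (B.erase u))) := by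
    rw [Finset.sum_comm, ← Finset.sum_add_distrib]
    refine Finset.sum_congr rfl fun u hu => ?_
    rw [Finset.compl_erase, Finset.sum_insert (by simpa using hu), Finset.insert_erase hu,
      smul_add, smul_add, Finset.smul_sum, Finset.smul_sum]
    congr 1
    · rw [smul_comm (a u) (koszulSign u _), smul_smul, koszulSign_mul_self, one_smul, smul_smul]
    · refine Finset.sum_congr rfl fun v _ => ?_
      rw [smul_comm (a u) (koszulSign v _), smul_smul, smul_smul]
  rw [e1, e2, ← Finset.sum_compl_add_sum B fun v => a v * x v, add_smul, Finset.sum_smul,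
    Finset.sum_smul]
  abel

/-- The chains of homological degree `i` and internal degree `m` of the Koszul complex of `M`, for
a family `D` of submodules of `M` in the role of the graded components. The case `D = ⊤` is the
Koszul complex without an internal grading. -/
def gradedChains (D : ℤ → Submodule K M) (i m : ℤ) : Submodule K (Finset σ → M) :=
  Submodule.pi Set.univ fun A => if (A.card : ℤ) = i then D (m - i) else ⊥

variable {K}

theorem mem_gradedChains {D : ℤ → Submodule K M} {i m : ℤ} {f : Finset σ → M} :
    f ∈ gradedChains K D i m ↔ ∀ A, if (A.card : ℤ) = i then f A ∈ D (m - i) else f A = 0 := by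
  simp only [gradedChains, Submodule.mem_pi, Set.mem_univ, true_implies]
  refine forall_congr' fun A => ?_
  split_ifs <;> simp

theorem eq_zero_of_mem_gradedChains {D : ℤ → Submodule K M} {i m : ℤ} {f : Finset σ → M}
    (hf : f ∈ gradedChains K D i m) {A : Finset σ} (hA : (A.card : ℤ) ≠ i) : f A = 0 := by
  simpa [hA] using mem_gradedChains.1 hf A

theorem apply_mem_of_mem_gradedChains {D : ℤ → Submodule K M} {i m : ℤ} {f : Finset σ → M}
    (hf : f ∈ gradedChains K D i m) (A : Finset σ) : f A ∈ D (m - i) := by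
  by_cases hA : (A.card : ℤ) = i
  · simpa [hA] using mem_gradedChains.1 hf A
  · rw [eq_zero_of_mem_gradedChains hf hA]; exact zero_mem _

variable (K)

/-- The cycles of `gradedChains`. -/
def gradedCycles (x : σ → R) (D : ℤ → Submodule K M) (i m : ℤ) : Submodule K (Finset σ → M) :=
  gradedChains K D i m ⊓ LinearMap.ker (moduleKoszulD K x)

/-- The boundaries of `gradedChains`. -/
def gradedBoundaries (x : σ → R) (D : ℤ → Submodule K M) (i m : ℤ) :
    Submodule K (Finset σ → M) :=
  (gradedChains K D (i + 1) m).map (moduleKoszulD K x)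

/-- The Koszul homology of `M` in homological degree `i` and internal degree `m`. -/
abbrev GradedHomology (x : σ → R) (D : ℤ → Submodule K M) (i m : ℤ) : Type _ :=
  gradedCycles K x D i m ⧸ (gradedBoundaries K x D i m).submoduleOf (gradedCycles K x D i m)

/-- The Koszul homology of `M` in homological degree `i` and internal degree `m` vanishes. -/
def IsExactAt (x : σ → R) (D : ℤ → Submodule K M) (i m : ℤ) : Prop :=
  gradedCycles K x D i m ≤ gradedBoundaries K x D i m

variable {K}

theorem moduleKoszulD_mem {x : σ → R} {D : ℤ → Submodule K M}
    (hx : ∀ v j, ∀ y ∈ D j, x v • y ∈ D (j + 1)) {i m : ℤ} {f : Finset σ → M}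
    (hf : f ∈ gradedChains K D (i + 1) m) : moduleKoszulD K x f ∈ gradedChains K D i m := by
  rw [mem_gradedChains]
  intro B
  split_ifs with hB
  · refine Submodule.sum_mem _ fun v _ => zsmul_mem ?_ _
    have := hx v _ _ (apply_mem_of_mem_gradedChains hf (insert v B))
    rwa [show m - (i + 1) + 1 = m - i by ring] at this
  · refine Finset.sum_eq_zero fun v hv => ?_
    rw [eq_zero_of_mem_gradedChains hf, smul_zero, smul_zero]
    rw [Finset.card_insert_of_notMem (Finset.mem_compl.1 hv)]
    push_cast; omega

theorem koszulWedge_mem {a : σ → R} {D : ℤ → Submodule K M} {e : ℤ}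
    (ha : ∀ v j, ∀ y ∈ D j, a v • y ∈ D (j + e - 1)) {i m : ℤ} {f : Finset σ → M}
    (hf : f ∈ gradedChains K D i m) :
    koszulWedge K a f ∈ gradedChains K D (i + 1) (m + e) := by
  rw [mem_gradedChains]
  intro A
  split_ifs with hA
  · refine Submodule.sum_mem _ fun v _ => zsmul_mem ?_ _
    have := ha v _ _ (apply_mem_of_mem_gradedChains hf (A.erase v))
    rwa [show m - i + e - 1 = m + e - (i + 1) by ring] at this
  · refine Finset.sum_eq_zero fun v hv => ?_
    rw [eq_zero_of_mem_gradedChains hf, smul_zero, smul_zero]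
    have := Finset.card_erase_add_one hv
    omega

theorem moduleKoszulD_smul (x : σ → R) (r : R) (f : Finset σ → M) :
    moduleKoszulD K x (r • f) = r • moduleKoszulD K x f := by
  funext B
  simp only [moduleKoszulD_apply, Pi.smul_apply, Finset.smul_sum]
  refine Finset.sum_congr rfl fun v _ => ?_
  rw [smul_comm (x v) r, smul_comm _ r]

theorem moduleKoszulD_comp (x : σ → R) (p : M →ₗ[R] N) (f : Finset σ → M) :
    moduleKoszulD K x (p ∘ f) = p ∘ moduleKoszulD K x f := by
  funext B
  simp [moduleKoszulD_apply]

/-! ### Koszul homology modulo a regular element -/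

variable (K) in
/-- A short exact sequence `0 → M(-e) → M → N → 0` whose first map is the multiplication by an
element `θ` of the ideal generated by `x`, together with families of submodules of `M` and `N`
that it respects. The element is written as `θ = ∑ a v * x v`, where multiplication by `a v` shifts
the family of `M` by `e - 1`, like a homogeneous coefficient of a homogeneous `θ` of degree `e`. -/
structure RegularStep (x a : σ → R) (D : ℤ → Submodule K M) (D' : ℤ → Submodule K N)
    (p : M →ₗ[R] N) (θ : R) (e : ℤ) : Prop where
  smul_mem : ∀ v j, ∀ y ∈ D j, x v • y ∈ D (j + 1)
  eq_sum : θ = ∑ v, a v * x v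
  coeff_smul_mem : ∀ v j, ∀ y ∈ D j, a v • y ∈ D (j + e - 1)
  regular : ∀ y : M, θ • y = 0 → y = 0
  map_eq : ∀ j, D' j = (D j).map (p.restrictScalars K)
  exists_of_map_eq_zero : ∀ j, ∀ y ∈ D j, p y = 0 → ∃ z ∈ D (j - e), θ • z = y
  map_smul_eq_zero : ∀ z, p (θ • z) = 0

namespace RegularStep

variable {x a : σ → R} {D : ℤ → Submodule K M} {D' : ℤ → Submodule K N}
    {p : M →ₗ[R] N} {θ : R} {e : ℤ} (h : RegularStep K x a D D' p θ e)
include h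

theorem theta_smul_eq {f : Finset σ → M} :
    θ • f = moduleKoszulD K x (koszulWedge K a f) + koszulWedge K a (moduleKoszulD K x f) := by
  rw [moduleKoszulD_koszulWedge, h.eq_sum]

theorem comp_smul (f : Finset σ → M) : p ∘ (θ • f) = 0 := by
  funext A
  exact h.map_smul_eq_zero _

theorem eq_zero_of_smul {f : Finset σ → M} (hf : θ • f = 0) : f = 0 := by
  funext A
  exact h.regular _ (congrFun hf A)

theorem comp_mem {i m : ℤ} {f : Finset σ → M} (hf : f ∈ gradedChains K D i m) :
    p ∘ f ∈ gradedChains K D' i m := by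
  rw [mem_gradedChains]
  intro A
  split_ifs with hA
  · rw [h.map_eq]
    exact ⟨f A, apply_mem_of_mem_gradedChains hf A, rfl⟩
  · simp [eq_zero_of_mem_gradedChains hf hA]

theorem exists_lift {i m : ℤ} {g : Finset σ → N} (hg : g ∈ gradedChains K D' i m) :
    ∃ f ∈ gradedChains K D i m, p ∘ f = g := by
  have : ∀ A, ∃ y, (if (A.card : ℤ) = i then y ∈ D (m - i) else y = 0) ∧ p y = g A := by
    intro A
    have hA := mem_gradedChains.1 hg A
    split_ifs at hA ⊢ with hc
    · rw [h.map_eq] at hA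
      obtain ⟨y, hy, hyA⟩ := hA
      exact ⟨y, hy, hyA⟩
    · exact ⟨0, rfl, by rw [map_zero, hA]⟩
  choose f hf hfg using this
  exact ⟨f, mem_gradedChains.2 hf, funext hfg⟩

theorem exists_smul_eq {i m : ℤ} {f : Finset σ → M} (hf : f ∈ gradedChains K D i m)
    (hpf : p ∘ f = 0) : ∃ u ∈ gradedChains K D i (m - e), θ • u = f := by
  have : ∀ A, ∃ y, (if (A.card : ℤ) = i then y ∈ D (m - e - i) else y = 0) ∧ θ • y = f A := by
    intro A
    have hA := mem_gradedChains.1 hf A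
    split_ifs at hA ⊢ with hc
    · obtain ⟨z, hz, hzA⟩ := h.exists_of_map_eq_zero _ _ hA (congrFun hpf A)
      exact ⟨z, by rwa [show m - e - i = m - i - e by ring], hzA⟩
    · exact ⟨0, rfl, by rw [smul_zero, hA]⟩
  choose u hu huf using this
  exact ⟨u, mem_gradedChains.2 hu, funext huf⟩

/-- The image in `N` of `(∑ a v e_v) ∧ f` is a cycle if `f` is a cycle, as its boundary is
`θ f`. -/
theorem comp_wedge_mem {i m : ℤ} {f : Finset σ → M} (hf : f ∈ gradedCycles K x D i m) :
    p ∘ koszulWedge K a f ∈ gradedCycles K x D' (i + 1) (m + e) := by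
  refine ⟨h.comp_mem (koszulWedge_mem h.coeff_smul_mem hf.1), ?_⟩
  have h0 : moduleKoszulD K x f = 0 := hf.2
  have := h.theta_smul_eq (f := f)
  rw [h0, map_zero, add_zero] at this
  change moduleKoszulD K x _ = 0
  rw [moduleKoszulD_comp, ← this, h.comp_smul]

/-- The map `H_i(M)_m → H_{i+1}(N)_{m+e}` that splits the connecting homomorphism, on the level of
cycles. -/
def wedgeMap (i m : ℤ) : gradedCycles K x D i m →ₗ[K] GradedHomology K x D' (i + 1) (m + e) :=
  Submodule.mkQ _ ∘ₗ
    { toFun := fun f => ⟨p ∘ koszulWedge K a f.1, h.comp_wedge_mem f.2⟩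
      map_add' := fun f g => by
        ext A
        simp
      map_smul' := fun c f => by
        ext A
        have : p (c • koszulWedge K a f.1 A) = c • p (koszulWedge K a f.1 A) :=
          (p.restrictScalars K).map_smul c _
        simp [this] }

theorem wedgeMap_eq_zero_iff {i m : ℤ} (f : gradedCycles K x D i m) :
    h.wedgeMap i m f = 0 ↔
      p ∘ koszulWedge K a f.1 ∈ gradedBoundaries K x D' (i + 1) (m + e) := by
  simp only [wedgeMap, LinearMap.comp_apply]
  rw [Submodule.mkQ_apply, Submodule.Quotient.mk_eq_zero]
  rfl

theorem mem_boundaries_of_wedge {i m : ℤ} {f : Finset σ → M} (hf : f ∈ gradedCycles K x D i m)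
    (hb : p ∘ koszulWedge K a f ∈ gradedBoundaries K x D' (i + 1) (m + e)) :
    f ∈ gradedBoundaries K x D i m := by
  obtain ⟨g', hg', hgf⟩ := hb
  obtain ⟨g, hg, rfl⟩ := h.exists_lift hg'
  have hfg : p ∘ (koszulWedge K a f - moduleKoszulD K x g) = 0 := by
    rw [moduleKoszulD_comp] at hgf
    funext A
    have := congrFun hgf A
    simp only [Function.comp_apply] at this
    simp [this]
  obtain ⟨u, hu, huf⟩ := h.exists_smul_eq
    (sub_mem (koszulWedge_mem h.coeff_smul_mem hf.1) (moduleKoszulD_mem h.smul_mem hg)) hfg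
  rw [add_sub_cancel_right] at hu
  refine ⟨u, hu, ?_⟩
  have h0 : moduleKoszulD K x f = 0 := hf.2
  have h1 := h.theta_smul_eq (f := f)
  rw [h0, map_zero, add_zero] at h1
  rw [← sub_eq_zero]
  apply h.eq_zero_of_smul
  rw [smul_sub, ← moduleKoszulD_smul, huf, map_sub, moduleKoszulD_moduleKoszulD, sub_zero, h1,
    sub_self]

theorem wedge_mem_boundaries {i m : ℤ} {f : Finset σ → M}
    (hb : f ∈ gradedBoundaries K x D i m) :
    p ∘ koszulWedge K a f ∈ gradedBoundaries K x D' (i + 1) (m + e) := by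
  obtain ⟨w, hw, rfl⟩ := hb
  refine ⟨-(p ∘ koszulWedge K a w), neg_mem (h.comp_mem (koszulWedge_mem h.coeff_smul_mem hw)), ?_⟩
  rw [map_neg, moduleKoszulD_comp, neg_eq_iff_add_eq_zero]
  have := h.comp_smul w
  rw [h.theta_smul_eq] at this
  funext A
  simpa using congrFun this A

theorem ker_wedgeMap (i m : ℤ) :
    LinearMap.ker (h.wedgeMap i m)
      = (gradedBoundaries K x D i m).submoduleOf (gradedCycles K x D i m) := by
  ext f
  rw [LinearMap.mem_ker, h.wedgeMap_eq_zero_iff]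
  exact ⟨fun hb => h.mem_boundaries_of_wedge f.2 hb, fun hb => h.wedge_mem_boundaries hb⟩

/-- Every cycle of `N` comes from a cycle of `M` up to boundaries, if the homology of `M`
vanishes in its degree. -/
theorem exists_wedge_add_boundary {i m : ℤ} (hM : IsExactAt K x D (i + 1) (m + e))
    {f : Finset σ → N} (hf : f ∈ gradedCycles K x D' (i + 1) (m + e)) :
    ∃ u ∈ gradedCycles K x D i m,
      f - p ∘ koszulWedge K a u ∈ gradedBoundaries K x D' (i + 1) (m + e) := by
  obtain ⟨g, hg, rfl⟩ := h.exists_lift hf.1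
  have hdg : p ∘ moduleKoszulD K x g = 0 := by
    rw [← moduleKoszulD_comp (K := K)]; exact hf.2
  obtain ⟨u, hu, hug⟩ := h.exists_smul_eq (moduleKoszulD_mem h.smul_mem hg) hdg
  rw [add_sub_cancel_right] at hu
  have hdu : moduleKoszulD K x u = 0 := by
    apply h.eq_zero_of_smul
    rw [← moduleKoszulD_smul, hug, moduleKoszulD_moduleKoszulD]
  have h1 := h.theta_smul_eq (f := u)
  rw [hdu, map_zero, add_zero, hug] at h1
  have hcyc : g - koszulWedge K a u ∈ gradedCycles K x D (i + 1) (m + e) :=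
    ⟨sub_mem hg (koszulWedge_mem h.coeff_smul_mem hu), by
      change moduleKoszulD K x _ = 0
      rw [map_sub, h1, sub_self]⟩
  obtain ⟨w, hw, hwg⟩ := hM hcyc
  refine ⟨u, ⟨hu, hdu⟩, p ∘ w, h.comp_mem hw, ?_⟩
  rw [moduleKoszulD_comp, hwg]
  funext A
  simp

theorem wedgeMap_surjective {i m : ℤ} (hM : IsExactAt K x D (i + 1) (m + e)) :
    Function.Surjective (h.wedgeMap i m) := by
  intro y
  obtain ⟨f, rfl⟩ := Submodule.mkQ_surjective _ y
  obtain ⟨u, hu, hb⟩ := h.exists_wedge_add_boundary hM f.2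
  refine ⟨⟨u, hu⟩, ?_⟩
  rw [← sub_eq_zero, ← neg_sub, neg_eq_zero]
  simp only [wedgeMap, LinearMap.comp_apply]
  rw [← map_sub, Submodule.mkQ_apply, Submodule.Quotient.mk_eq_zero]
  exact hb

theorem isExactAt_of_quotient {i m : ℤ} (hN : IsExactAt K x D' (i + 1) (m + e)) :
    IsExactAt K x D i m :=
  fun _ hf => h.mem_boundaries_of_wedge hf (hN (h.comp_wedge_mem hf))

theorem isExactAt_quotient {i m : ℤ} (hM : IsExactAt K x D i m)
    (hM' : IsExactAt K x D (i + 1) (m + e)) : IsExactAt K x D' (i + 1) (m + e) := by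
  intro f hf
  obtain ⟨u, hu, hb⟩ := h.exists_wedge_add_boundary hM' hf
  have := add_mem hb (h.wedge_mem_boundaries (hM hu))
  rwa [sub_add_cancel] at this

/-- If `H_{i+1}(M)_{m+e} = 0`, then `H_i(M)_m` and `H_{i+1}(N)_{m+e}` are isomorphic. -/
theorem finrank_gradedHomology_eq {i m : ℤ} (hM : IsExactAt K x D (i + 1) (m + e)) :
    Module.finrank K (GradedHomology K x D i m)
      = Module.finrank K (GradedHomology K x D' (i + 1) (m + e)) :=
  ((Submodule.quotEquivOfEq _ _ (h.ker_wedgeMap i m).symm).trans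
    ((h.wedgeMap i m).quotKerEquivOfSurjective (h.wedgeMap_surjective hM))).finrank_eq

end RegularStep

end Koszul

/-! ### Depth through the Koszul complex -/

section Depth

variable (K : Type*) {R σ : Type*} [Field K] [CommRing R] [Algebra K R]
  [Fintype σ] [DecidableEq σ]

/-- The Koszul homology of `M` with respect to `x` vanishes in homological degrees above
`#σ - k`. This expresses that the ideal generated by `x` has depth at least `k` on `M`. -/
def HasKoszulDepth (x : σ → R) (M : Type*) [AddCommGroup M] [Module K M] [Module R M]
    [IsScalarTower K R M] (k : ℕ) : Prop :=
  ∀ i m : ℤ, (Fintype.card σ : ℤ) - k < i → IsExactAt K x (fun _ => (⊤ : Submodule K M)) i m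

variable {K} {M N : Type*}
  [AddCommGroup M] [Module K M] [Module R M] [IsScalarTower K R M]
  [AddCommGroup N] [Module K N] [Module R N] [IsScalarTower K R N]

theorem eq_zero_of_mem_gradedChains_of_card_lt {D : ℤ → Submodule K M} {i m : ℤ}
    (hi : (Fintype.card σ : ℤ) < i) {f : Finset σ → M} (hf : f ∈ gradedChains K D i m) :
    f = 0 := by
  funext A
  refine eq_zero_of_mem_gradedChains hf fun hA => ?_
  have := Finset.card_le_univ A
  omega

theorem isExactAt_of_card_lt (x : σ → R) (D : ℤ → Submodule K M) {i m : ℤ}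
    (hi : (Fintype.card σ : ℤ) < i) : IsExactAt K x D i m := by
  intro f hf
  rw [eq_zero_of_mem_gradedChains_of_card_lt hi hf.1]
  exact zero_mem _

theorem regularStep_top {x a : σ → R} {p : M →ₗ[R] N} {θ : R} (hθ : θ = ∑ v, a v * x v)
    (hp : Function.Surjective p) (hreg : IsSMulRegular M θ)
    (hker : ∀ y, p y = 0 → ∃ z, θ • z = y) (hz : ∀ z, p (θ • z) = 0) :
    RegularStep K x a (fun _ => (⊤ : Submodule K M)) (fun _ => (⊤ : Submodule K N)) p θ 0 where
  smul_mem := fun _ _ _ _ => trivial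
  eq_sum := hθ
  coeff_smul_mem := fun _ _ _ _ => trivial
  regular := fun y hy => hreg (by simpa using hy)
  map_eq := fun _ => by
    rw [Submodule.map_top, LinearMap.range_eq_top.2]
    exact hp
  exists_of_map_eq_zero := fun _ y _ hy => by
    obtain ⟨z, hz⟩ := hker y hy
    exact ⟨z, trivial, hz⟩
  map_smul_eq_zero := hz

open scoped Pointwise in
/-- A regular sequence of length `k` in the ideal generated by `x` makes the Koszul homology vanish
above degree `#σ - k`. -/
theorem hasKoszulDepth_of_isWeaklyRegular (x : σ → R) (rs : List R) (M : Type*)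
    [AddCommGroup M] [Module K M] [Module R M] [IsScalarTower K R M]
    (hmem : ∀ r ∈ rs, r ∈ Ideal.span (Set.range x))
    (hrs : RingTheory.Sequence.IsWeaklyRegular M rs) : HasKoszulDepth K x M rs.length := by
  induction rs generalizing M with
  | nil =>
    intro i m hi
    exact isExactAt_of_card_lt x _ (by simpa using hi)
  | cons r rs ih =>
    rw [RingTheory.Sequence.isWeaklyRegular_cons_iff] at hrs
    obtain ⟨a, ha⟩ := Ideal.mem_span_range_iff_exists_fun.1 (hmem r List.mem_cons_self)
    have step := regularStep_top (K := K) (x := x) (a := a)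
      (p := Submodule.mkQ (r • (⊤ : Submodule R M))) ha.symm
      (Submodule.mkQ_surjective _) hrs.1
      (fun y hy => by
        rw [Submodule.mkQ_apply, Submodule.Quotient.mk_eq_zero,
          Submodule.mem_smul_pointwise_iff_exists] at hy
        obtain ⟨z, -, hz⟩ := hy
        exact ⟨z, hz⟩)
      (fun z => by
        rw [Submodule.mkQ_apply, Submodule.Quotient.mk_eq_zero]
        exact Submodule.smul_mem_pointwise_smul z r ⊤ trivial)
    have := ih (QuotSMulTop r M) (fun s hs => hmem s (List.mem_cons_of_mem _ hs)) hrs.2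
    intro i m hi
    refine step.isExactAt_of_quotient (this _ _ ?_)
    rw [List.length_cons] at hi
    push_cast at hi
    omega

/-- The Koszul depth drops by at most one modulo a regular element of the ideal generated by
`x`. -/
theorem HasKoszulDepth.quotient {x a : σ → R} {p : M →ₗ[R] N} {θ : R}
    (step : RegularStep K x a (fun _ => (⊤ : Submodule K M)) (fun _ => (⊤ : Submodule K N)) p θ 0)
    {k : ℕ} (h : HasKoszulDepth K x M (k + 1)) : HasKoszulDepth K x N k := by
  intro i m hi
  have := step.isExactAt_quotient (i := i - 1) (m := m) (h _ _ (by push_cast; omega))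
    (h _ _ (by push_cast; omega))
  rwa [sub_add_cancel, add_zero] at this

theorem HasKoszulDepth.mono {x : σ → R} {k l : ℕ} (h : HasKoszulDepth K x M k) (hl : l ≤ k) :
    HasKoszulDepth K x M l :=
  fun i m hi => h i m (by omega)

/-- The chain `y e_σ` in the top homological degree. -/
def topChain (σ : Type*) [Fintype σ] [DecidableEq σ] {M : Type*} [AddCommGroup M] (y : M) :
    Finset σ → M :=
  fun A => if A = Finset.univ then y else 0

theorem topChain_mem {D : ℤ → Submodule K M} {m : ℤ} {y : M}
    (hy : y ∈ D (m - Fintype.card σ)) :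
    topChain σ y ∈ gradedChains K D (Fintype.card σ) m := by
  rw [mem_gradedChains]
  intro A
  by_cases hA : A = Finset.univ
  · simpa [hA, topChain] using hy
  · have : A.card ≠ Fintype.card σ := fun h => hA (Finset.card_eq_iff_eq_univ A |>.1 h)
    simp [hA, topChain, this]

theorem eq_topChain {D : ℤ → Submodule K M} {m : ℤ} {f : Finset σ → M}
    (hf : f ∈ gradedChains K D (Fintype.card σ) m) : f = topChain σ (f Finset.univ) := by
  funext A
  by_cases hA : A = Finset.univ
  · simp [hA, topChain]
  · have : A.card ≠ Fintype.card σ := fun h => hA (Finset.card_eq_iff_eq_univ A |>.1 h)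
    rw [eq_zero_of_mem_gradedChains hf (by exact_mod_cast this)]
    simp [hA, topChain]

theorem moduleKoszulD_topChain_eq_zero_iff (x : σ → R) (y : M) :
    moduleKoszulD K x (topChain σ y) = 0 ↔ ∀ v, x v • y = 0 := by
  constructor
  · intro h v
    have := congrFun h (Finset.univ.erase v)
    rw [moduleKoszulD_apply, Finset.sum_eq_single v] at this
    · rw [Finset.insert_erase (Finset.mem_univ v)] at this
      have h2 := congrArg (fun z => koszulSign v (Finset.univ.erase v) • z) this
      simpa [smul_smul, koszulSign_mul_self, topChain] using h2
    · intro b hb hbv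
      simp [hbv] at hb
    · simp
  · intro h
    funext B
    refine Finset.sum_eq_zero fun v _ => ?_
    unfold topChain
    split_ifs <;> simp [h]

/-- If the depth is positive, then no nonzero element is killed by all the `x v`. -/
theorem HasKoszulDepth.eq_zero_of_smul_eq_zero {x : σ → R} (h : HasKoszulDepth K x M 1) {y : M}
    (hy : ∀ v, x v • y = 0) : y = 0 := by
  have hc : topChain σ y ∈ gradedCycles K x (fun _ => (⊤ : Submodule K M)) (Fintype.card σ) 0 :=
    ⟨topChain_mem trivial, (moduleKoszulD_topChain_eq_zero_iff (K := K) x y).2 hy⟩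
  obtain ⟨g, hg, hgy⟩ := h _ _ (by push_cast; omega) hc
  rw [eq_zero_of_mem_gradedChains_of_card_lt (by omega) hg, map_zero] at hgy
  simpa [topChain] using (congrFun hgy Finset.univ).symm

end Depth

/-! ### Homogeneous regular elements -/

section HomogeneousRegular

attribute [local instance] MvPolynomial.gradedAlgebra

variable {K σ : Type*} [Field K]

/-- Prime avoidance by a homogeneous element of positive degree. -/
theorem exists_isHomogeneous_notMem (s : Finset (Ideal (MvPolynomial σ K)))
    (hs : ∀ P ∈ s, P.IsPrime ∧ P.IsHomogeneous (homogeneousSubmodule σ K) ∧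
      ∃ v, (X v : MvPolynomial σ K) ∉ P) :
    ∃ (θ : MvPolynomial σ K) (e : ℕ), 0 < e ∧ θ.IsHomogeneous e ∧ ∀ P ∈ s, θ ∉ P := by
  classical
  induction s using Finset.strongInduction with
  | H s ih =>
  rcases s.eq_empty_or_nonempty with rfl | hne
  · exact ⟨0, 1, one_pos, isHomogeneous_zero _ _ _, by simp⟩
  -- For a minimal member `P`, every other member contains an element outside `P`.
  obtain ⟨P, hP⟩ := s.exists_minimal hne
  obtain ⟨hPprime, -, v, hv⟩ := hs P hP.prop
  obtain ⟨θ, a, ha, hθ, hθs⟩ := ih (s.erase P) (Finset.erase_ssubset hP.prop)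
    fun Q hQ => hs Q (Finset.mem_of_mem_erase hQ)
  by_cases hθP : θ ∈ P
  swap
  · refine ⟨θ, a, ha, hθ, fun Q hQ => ?_⟩
    by_cases hQP : Q = P
    · rwa [hQP]
    · exact hθs Q (Finset.mem_erase.2 ⟨hQP, hQ⟩)
  have hex : ∀ Q ∈ s.erase P, ∃ (q : MvPolynomial σ K) (d : ℕ),
      q.IsHomogeneous d ∧ q ∈ Q ∧ q ∉ P := by
    intro Q hQ
    have hQs := Finset.mem_of_mem_erase hQ
    have hQP : ¬ Q ≤ P := fun hle =>
      Finset.ne_of_mem_erase hQ (le_antisymm hle (hP.le_of_le hQs hle))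
    obtain ⟨f, hfQ, hfP⟩ := SetLike.not_le_iff_exists.1 hQP
    by_contra! hcon
    apply hfP
    rw [← sum_homogeneousComponent f]
    exact sum_mem fun j _ => hcon _ j (homogeneousComponent_isHomogeneous j f)
      (homogeneousComponent_mem_of_mem (hs Q hQs).2.1 hfQ j)
  choose! q d hq using hex
  set g : MvPolynomial σ K := X v * ∏ Q ∈ s.erase P, q Q with hg
  set b : ℕ := 1 + ∑ Q ∈ s.erase P, d Q with hb
  have hgb : g.IsHomogeneous b :=
    (isHomogeneous_X K v).mul (IsHomogeneous.prod _ _ _ fun Q hQ => (hq Q hQ).1)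
  have hgP : g ∉ P := fun h => by
    rcases hPprime.mem_or_mem h with h | h
    · exact hv h
    · obtain ⟨Q, hQ, hQP⟩ := (Ideal.IsPrime.prod_mem_iff (p := P)).1 h
      exact (hq Q hQ).2.2 hQP
  refine ⟨θ ^ b + g ^ a, a * b, Nat.mul_pos ha (by omega), ?_, fun Q hQ => ?_⟩
  · refine (hθ.pow b).add ?_
    rw [mul_comm]
    exact hgb.pow a
  · by_cases hQP : Q = P
    · subst hQP
      intro h
      exact hgP (hPprime.mem_of_pow_mem a
        ((Ideal.add_mem_iff_right _ (Ideal.pow_mem_of_mem _ hθP b (by omega))).1 h))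
    · have hQ' : Q ∈ s.erase P := Finset.mem_erase.2 ⟨hQP, hQ⟩
      have hgQ : g ∈ Q := Ideal.mul_mem_left _ _ (Ideal.prod_mem _ hQ' (hq Q hQ').2.1)
      intro h
      exact hθs Q hQ' ((hs Q hQ).1.mem_of_pow_mem b
        ((Ideal.add_mem_iff_left _ (Ideal.pow_mem_of_mem _ hgQ a ha)).1 h))

/-- If no nonzero element of `S / J` is killed by all variables, then there is a homogeneous
nonzerodivisor of positive degree: it only has to avoid the homogeneous cores of the associated
primes. -/
theorem exists_isHomogeneous_isSMulRegular [Finite σ] (J : Ideal (MvPolynomial σ K))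
    (hsoc : ∀ y : MvPolynomial σ K ⧸ J, (∀ v, (X v : MvPolynomial σ K) • y = 0) → y = 0) :
    ∃ (θ : MvPolynomial σ K) (e : ℕ), 0 < e ∧ θ.IsHomogeneous e ∧
      IsSMulRegular (MvPolynomial σ K ⧸ J) θ := by
  classical
  have hfin := associatedPrimes.finite (MvPolynomial σ K) (MvPolynomial σ K ⧸ J)
  obtain ⟨θ, e, he, hθ, hθs⟩ := exists_isHomogeneous_notMem
    (hfin.toFinset.image fun P => (P.homogeneousCore (homogeneousSubmodule σ K)).toIdeal) (by
      intro Q hQ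
      obtain ⟨P, hP, rfl⟩ := Finset.mem_image.1 hQ
      rw [Set.Finite.mem_toFinset] at hP
      have hprime : P.IsPrime := hP.isPrime
      refine ⟨hprime.homogeneousCore, HomogeneousIdeal.isHomogeneous _, ?_⟩
      by_contra! hcon
      obtain ⟨-, y, hy⟩ := isAssociatedPrime_iff.1 hP
      have : y = 0 := hsoc y fun v => by
        have := Ideal.toIdeal_homogeneousCore_le _ _ (hcon v)
        rw [hy, Submodule.mem_colon_singleton] at this
        simpa using this
      rw [this] at hy
      apply hprime.ne_top
      rw [hy]
      simp)
  refine ⟨θ, e, he, hθ, ?_⟩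
  by_contra hreg
  have hmem : θ ∈ (⋃ P ∈ associatedPrimes (MvPolynomial σ K) (MvPolynomial σ K ⧸ J),
      (P : Set (MvPolynomial σ K))) := by
    rw [biUnion_associatedPrimes_eq_compl_regular]
    exact hreg
  simp only [Set.mem_iUnion] at hmem
  obtain ⟨P, hP, hθP⟩ := hmem
  exact hθs _ (Finset.mem_image.2 ⟨P, hfin.mem_toFinset.2 hP, rfl⟩)
    (Ideal.mem_homogeneousCore_of_homogeneous_of_mem ⟨e, hθ⟩ hθP)

end HomogeneousRegular

/-! ### Standard graded algebras modulo a homogeneous regular element -/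

section GradedQuotient

attribute [local instance] MvPolynomial.gradedAlgebra

variable {K σ : Type*} [Field K]

theorem homogeneousComponent_mul_of_isHomogeneous {q : MvPolynomial σ K} {d : ℕ}
    (hq : q.IsHomogeneous d) (p : MvPolynomial σ K) (j : ℕ) :
    homogeneousComponent j (p * q) = if d ≤ j then homogeneousComponent (j - d) p * q else 0 := by
  have key : ∀ (n : ℕ) (f : MvPolynomial σ K), homogeneousComponent n f
      = (DirectSum.decompose (homogeneousSubmodule σ K) f n : MvPolynomial σ K) :=
    fun n f => (decomposition.decompose'_apply f n).symm
  rw [key, key]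
  exact DirectSum.coe_decompose_mul_of_right_mem (homogeneousSubmodule σ K) (a := p) j
    ((mem_homogeneousSubmodule d q).2 hq)

theorem mem_idealOfVars_iff (p : MvPolynomial σ K) : p ∈ idealOfVars σ K ↔ coeff 0 p = 0 := by
  have := mem_pow_idealOfVars_iff' (σ := σ) (R := K) 1 p
  rw [pow_one] at this
  rw [this]
  constructor
  · intro h
    exact h 0 (by simp)
  · intro h x hx
    have : x = 0 := by
      rw [← Finsupp.degree_eq_zero_iff]
      omega
    rwa [this]

/-- The degree `j` component of `S / J`, for an integer `j`. -/
def quotientGrading (J : Ideal (MvPolynomial σ K)) (j : ℤ) : Submodule K (MvPolynomial σ K ⧸ J) :=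
  if 0 ≤ j then degreePart J j.toNat else ⊥

theorem quotientGrading_natCast (J : Ideal (MvPolynomial σ K)) (j : ℕ) :
    quotientGrading J j = degreePart J j := by
  simp [quotientGrading]

theorem quotientGrading_of_neg (J : Ideal (MvPolynomial σ K)) {j : ℤ} (hj : j < 0) :
    quotientGrading J j = ⊥ := by
  simp [quotientGrading, hj]

theorem mem_degreePart {J : Ideal (MvPolynomial σ K)} {j : ℕ} {y : MvPolynomial σ K ⧸ J} :
    y ∈ degreePart J j ↔ ∃ p : MvPolynomial σ K, p.IsHomogeneous j ∧ Ideal.Quotient.mk J p = y :=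
  Iff.rfl

theorem smul_mem_quotientGrading {J : Ideal (MvPolynomial σ K)} {q : MvPolynomial σ K} {d : ℕ}
    (hq : q.IsHomogeneous d) {j k : ℤ} (hk : k = j + d) {y : MvPolynomial σ K ⧸ J}
    (hy : y ∈ quotientGrading J j) :
    q • y ∈ quotientGrading J k := by
  rcases lt_or_ge j 0 with hj | hj
  · rw [quotientGrading_of_neg J hj, Submodule.mem_bot] at hy
    rw [hy, smul_zero]
    exact zero_mem _
  · lift j to ℕ using hj
    subst hk
    rw [quotientGrading_natCast, mem_degreePart] at hy
    obtain ⟨p, hp, rfl⟩ := hy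
    rw [← Nat.cast_add, quotientGrading_natCast, mem_degreePart]
    exact ⟨q * p, by rw [add_comm]; exact hq.mul hp, rfl⟩

variable [Fintype σ]

/-- A homogeneous polynomial of positive degree `e` is a combination of the variables with
homogeneous coefficients of degree `e - 1`. -/
theorem exists_eq_sum_mul_X {θ : MvPolynomial σ K} {e : ℕ} (he : 0 < e)
    (hθ : θ.IsHomogeneous e) :
    ∃ a : σ → MvPolynomial σ K, (∀ v, (a v).IsHomogeneous (e - 1)) ∧ θ = ∑ v, a v * X v := by
  have hmem : θ ∈ idealOfVars σ K := by
    rw [mem_idealOfVars_iff]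
    exact hθ.coeff_eq_zero (by simpa using he.ne)
  obtain ⟨c, hc⟩ := Ideal.mem_span_range_iff_exists_fun.1 hmem
  refine ⟨fun v => homogeneousComponent (e - 1) (c v),
    fun v => homogeneousComponent_isHomogeneous _ _, ?_⟩
  rw [← homogeneousComponent_eq_self hθ, ← hc, map_sum]
  refine Finset.sum_congr rfl fun v _ => ?_
  rw [homogeneousComponent_mul_of_isHomogeneous (isHomogeneous_X K v), if_pos (show 1 ≤ e from he)]

theorem isHomogeneous_sup_span {J : Ideal (MvPolynomial σ K)}
    (hJ : J.IsHomogeneous (homogeneousSubmodule σ K)) {θ : MvPolynomial σ K} {e : ℕ}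
    (hθ : θ.IsHomogeneous e) :
    (J ⊔ Ideal.span {θ}).IsHomogeneous (homogeneousSubmodule σ K) :=
  hJ.sup (Ideal.homogeneous_span _ _ (by rintro _ rfl; exact ⟨e, hθ⟩))

/-- The projection `S / J → S / (J, θ)`. -/
abbrev modElement (J : Ideal (MvPolynomial σ K)) (θ : MvPolynomial σ K) :
    (MvPolynomial σ K ⧸ J) →ₗ[MvPolynomial σ K] (MvPolynomial σ K ⧸ (J ⊔ Ideal.span {θ})) :=
  (Ideal.Quotient.factorₐ (MvPolynomial σ K) (le_sup_left : J ≤ J ⊔ Ideal.span {θ})).toLinearMap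

theorem modElement_mk (J : Ideal (MvPolynomial σ K)) (θ p : MvPolynomial σ K) :
    modElement J θ (Ideal.Quotient.mk J p) = Ideal.Quotient.mk _ p := rfl

theorem modElement_smul (J : Ideal (MvPolynomial σ K)) (θ : MvPolynomial σ K)
    (z : MvPolynomial σ K ⧸ J) : modElement J θ (θ • z) = 0 := by
  obtain ⟨p, rfl⟩ := Ideal.Quotient.mk_surjective z
  change Ideal.Quotient.mk _ (θ * p) = 0
  rw [Ideal.Quotient.eq_zero_iff_mem]
  exact Ideal.mul_mem_right _ _ (Ideal.mem_sup_right (Ideal.mem_span_singleton_self θ))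

theorem exists_smul_eq_of_modElement_eq_zero {J : Ideal (MvPolynomial σ K)} {θ : MvPolynomial σ K}
    {y : MvPolynomial σ K ⧸ J} (hy : modElement J θ y = 0) : ∃ z, θ • z = y := by
  obtain ⟨p, rfl⟩ := Ideal.Quotient.mk_surjective y
  rw [modElement_mk, Ideal.Quotient.eq_zero_iff_mem, Submodule.mem_sup] at hy
  obtain ⟨q, hq, g, hg, rfl⟩ := hy
  obtain ⟨g, rfl⟩ := Ideal.mem_span_singleton.1 hg
  refine ⟨Ideal.Quotient.mk J g, ?_⟩
  rw [map_add, Ideal.Quotient.eq_zero_iff_mem.2 hq, zero_add]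
  rfl

variable [DecidableEq σ]

theorem exists_regularStep_top {J : Ideal (MvPolynomial σ K)} {θ : MvPolynomial σ K} {e : ℕ}
    (he : 0 < e) (hθ : θ.IsHomogeneous e) (hreg : IsSMulRegular (MvPolynomial σ K ⧸ J) θ) :
    ∃ a, RegularStep K X a (fun _ => (⊤ : Submodule K (MvPolynomial σ K ⧸ J)))
      (fun _ => (⊤ : Submodule K (MvPolynomial σ K ⧸ (J ⊔ Ideal.span {θ}))))
      (modElement J θ) θ 0 := by
  obtain ⟨a, -, ha⟩ := exists_eq_sum_mul_X he hθ
  exact ⟨a, regularStep_top ha (Ideal.Quotient.factor_surjective le_sup_left) hreg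
    (fun y hy => exists_smul_eq_of_modElement_eq_zero hy) (modElement_smul J θ)⟩

theorem exists_regularStep_quotientGrading {J : Ideal (MvPolynomial σ K)}
    (hJ : J.IsHomogeneous (homogeneousSubmodule σ K)) {θ : MvPolynomial σ K} {e : ℕ}
    (he : 0 < e) (hθ : θ.IsHomogeneous e) (hreg : IsSMulRegular (MvPolynomial σ K ⧸ J) θ) :
    ∃ a, RegularStep K X a (quotientGrading J) (quotientGrading (J ⊔ Ideal.span {θ}))
      (modElement J θ) θ e := by
  obtain ⟨a, hah, ha⟩ := exists_eq_sum_mul_X he hθ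
  refine ⟨a, ⟨?_, ha, ?_, ?_, ?_, ?_, modElement_smul J θ⟩⟩
  · intro v j y hy
    exact smul_mem_quotientGrading (isHomogeneous_X K v) (by simp) hy
  · intro v j y hy
    exact smul_mem_quotientGrading (hah v)
      (by push_cast [Nat.cast_sub (show 1 ≤ e from he)]; ring) hy
  · intro y hy
    exact hreg (by simpa using hy)
  · intro j
    rcases lt_or_ge j 0 with hj | hj
    · rw [quotientGrading_of_neg _ hj, quotientGrading_of_neg _ hj, Submodule.map_bot]
    · lift j to ℕ using hj
      rw [quotientGrading_natCast, quotientGrading_natCast, degreePart, degreePart,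
        ← Submodule.map_comp]
      rfl
  · intro j y hy hy0
    rcases lt_or_ge j 0 with hj | hj
    · rw [quotientGrading_of_neg _ hj, Submodule.mem_bot] at hy
      exact ⟨0, zero_mem _, by rw [smul_zero, hy]⟩
    lift j to ℕ using hj
    rw [quotientGrading_natCast, mem_degreePart] at hy
    obtain ⟨p, hp, rfl⟩ := hy
    rw [modElement_mk, Ideal.Quotient.eq_zero_iff_mem, Submodule.mem_sup] at hy0
    obtain ⟨q, hq, g, hg, hqg⟩ := hy0
    obtain ⟨g, rfl⟩ := Ideal.mem_span_singleton.1 hg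
    -- Only the components of `q` and `θ * g` in degree `j` matter.
    rw [← homogeneousComponent_eq_self hp, ← hqg, map_add, mul_comm,
      homogeneousComponent_mul_of_isHomogeneous hθ, map_add,
      Ideal.Quotient.eq_zero_iff_mem.2 (homogeneousComponent_mem_of_mem hJ hq j), zero_add]
    split_ifs with hej
    · refine ⟨Ideal.Quotient.mk J (homogeneousComponent (j - e) g), ?_, ?_⟩
      · rw [← Nat.cast_sub hej, quotientGrading_natCast, mem_degreePart]
        exact ⟨_, homogeneousComponent_isHomogeneous _ _, rfl⟩
      · rw [mul_comm]; rfl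
    · exact ⟨0, zero_mem _, by rw [smul_zero, map_zero]⟩

/-! ### Reduction to an Artinian algebra -/

/-- `RegularReduction J A c E` means that `A` is obtained from `J` by adding successively `c`
homogeneous elements of positive degrees with sum `E`, each a nonzerodivisor modulo the
preceding ideal. -/
inductive RegularReduction : Ideal (MvPolynomial σ K) → Ideal (MvPolynomial σ K) → ℕ → ℕ → Prop
  | refl (J : Ideal (MvPolynomial σ K)) : RegularReduction J J 0 0
  | step {J A : Ideal (MvPolynomial σ K)} {θ : MvPolynomial σ K} {e c E : ℕ} (he : 0 < e)
      (hθ : θ.IsHomogeneous e) (hreg : IsSMulRegular (MvPolynomial σ K ⧸ J) θ)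
      (h : RegularReduction (J ⊔ Ideal.span {θ}) A c E) : RegularReduction J A (c + 1) (E + e)

theorem RegularReduction.trans {J A B : Ideal (MvPolynomial σ K)} {c E c' E' : ℕ}
    (h : RegularReduction J A c E) (h' : RegularReduction A B c' E') :
    RegularReduction J B (c + c') (E + E') := by
  induction h with
  | refl J => simpa using h'
  | step he hθ hreg _ ih =>
    have := RegularReduction.step he hθ hreg (ih h')
    convert this using 1 <;> omega

theorem le_idealOfVars_of_isHomogeneous {P : Ideal (MvPolynomial σ K)}
    (hP : P.IsHomogeneous (homogeneousSubmodule σ K)) (hne : P ≠ ⊤) : P ≤ idealOfVars σ K := by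
  intro f hf
  rw [mem_idealOfVars_iff]
  by_contra h0
  have := homogeneousComponent_mem_of_mem hP hf 0
  rw [homogeneousComponent_zero] at this
  exact hne (Ideal.eq_top_of_isUnit_mem _ this ((IsUnit.mk0 _ h0).map C))

/-- In a standard graded algebra of dimension zero the variables are nilpotent: the homogeneous
core of a prime that avoids a variable would be a nonmaximal prime. -/
theorem X_mem_radical_of_ringKrullDim_le_zero {J : Ideal (MvPolynomial σ K)}
    (hJ : J.IsHomogeneous (homogeneousSubmodule σ K))
    (hdim : ringKrullDim (MvPolynomial σ K ⧸ J) ≤ 0) (v : σ) : X v ∈ J.radical := by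
  by_contra hv
  rw [Ideal.radical_eq_sInf, Ideal.mem_sInf] at hv
  push Not at hv
  obtain ⟨P, ⟨hJP, hP⟩, hvP⟩ := hv
  set Q := (P.homogeneousCore (homogeneousSubmodule σ K)).toIdeal with hQ
  have hQP : Q ≤ P := Ideal.toIdeal_homogeneousCore_le _ _
  have hQprime : Q.IsPrime := hP.homogeneousCore
  have hQhom : Q.IsHomogeneous (homogeneousSubmodule σ K) := HomogeneousIdeal.isHomogeneous _
  have hJQ : J ≤ Q := by
    rw [← hJ.toIdeal_homogeneousCore_eq_self]
    exact Ideal.homogeneousCore_mono _ hJP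
  have hQm := le_idealOfVars_of_isHomogeneous hQhom hQprime.ne_top
  have hdimQ : ringKrullDim (MvPolynomial σ K ⧸ Q) ≤ (0 : ℕ) :=
    (ringKrullDim_le_of_surjective _ (Ideal.Quotient.factor_surjective hJQ)).trans hdim
  have hzero := Ring.krullDimLE_zero_iff.1 (Ring.krullDimLE_iff.2 hdimQ) ⊥ Ideal.isPrime_bot
  have hQmax : Q.IsMaximal := Ideal.Quotient.maximal_of_isField _
    (by
      by_contra hf
      exact Ring.ne_bot_of_isMaximal_of_not_isField hzero hf rfl)
  have htop : idealOfVars σ K ≠ ⊤ := by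
    rw [Ideal.ne_top_iff_one, mem_idealOfVars_iff]
    simp
  have := hQmax.eq_of_le htop hQm
  exact hvP (hQP (this ▸ Ideal.subset_span ⟨v, rfl⟩))

/-- A standard graded algebra whose depth is at least its dimension can be reduced to an algebra
with nilpotent variables modulo a sequence of homogeneous elements, each regular modulo the
preceding ones. -/
theorem exists_regularReduction {J : Ideal (MvPolynomial σ K)} (d : ℕ)
    (hJ : J.IsHomogeneous (homogeneousSubmodule σ K)) (hne : J ≠ ⊤)
    (hdepth : HasKoszulDepth K (X : σ → MvPolynomial σ K) (MvPolynomial σ K ⧸ J) d)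
    (hdim : ringKrullDim (MvPolynomial σ K ⧸ J) ≤ d) :
    ∃ A c E, RegularReduction J A c E ∧ A.IsHomogeneous (homogeneousSubmodule σ K) ∧ A ≠ ⊤ ∧
      ∀ v, X v ∈ A.radical := by
  induction d generalizing J with
  | zero =>
    exact ⟨J, 0, 0, .refl J, hJ, hne,
      X_mem_radical_of_ringKrullDim_le_zero hJ (by simpa using hdim)⟩
  | succ d ih =>
    obtain ⟨θ, e, he, hθ, hreg⟩ := exists_isHomogeneous_isSMulRegular J
      fun y hy => (hdepth.mono (by omega)).eq_zero_of_smul_eq_zero hy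
    obtain ⟨a, step⟩ := exists_regularStep_top he hθ hreg
    have hmem : ∀ f ∈ J ⊔ Ideal.span {θ}, coeff 0 f = 0 := by
      intro f hf
      rw [← mem_idealOfVars_iff]
      refine sup_le (le_idealOfVars_of_isHomogeneous hJ hne) ?_ hf
      rw [Ideal.span_singleton_le_iff_mem, mem_idealOfVars_iff]
      exact hθ.coeff_eq_zero (by simpa using he.ne)
    have hne' : J ⊔ Ideal.span {θ} ≠ ⊤ := by
      intro htop
      have := hmem 1 (htop ▸ trivial)
      simp at this
    have hdim' : ringKrullDim (MvPolynomial σ K ⧸ (J ⊔ Ideal.span {θ})) ≤ d := by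
      have h1 := ringKrullDim_succ_le_of_surjective
        (Ideal.Quotient.factor (le_sup_left : J ≤ J ⊔ Ideal.span {θ}))
        (Ideal.Quotient.factor_surjective _) (r := Ideal.Quotient.mk J θ)
        (by
          rw [mem_nonZeroDivisors_iff_right]
          intro z hz
          refine hreg ?_
          simp only [smul_zero]
          rw [← hz, mul_comm]
          rfl)
        (by
          rw [Ideal.Quotient.factor_mk, Ideal.Quotient.eq_zero_iff_mem]
          exact Ideal.mem_sup_right (Ideal.mem_span_singleton_self θ))
      have h2 := h1.trans hdim
      push_cast at h2
      exact ENat.WithBot.add_le_add_one_right_iff.1 h2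
    obtain ⟨A, c, E, hA, hAh, hAne, hrad⟩ := ih (isHomogeneous_sup_span hJ hθ) hne'
      (hdepth.quotient step) hdim'
    exact ⟨A, c + 1, E + e, .step he hθ hreg hA, hAh, hAne, hrad⟩

end GradedQuotient

/-! ### Betti numbers and the socle of an Artinian reduction -/

section Betti

attribute [local instance] MvPolynomial.gradedAlgebra

variable {K σ : Type*} [Field K] [Fintype σ] [DecidableEq σ]

/-- The dimension of the Koszul homology of `S / J` in homological degree `i` and internal degree
`m`, for integers `i` and `m`. -/
def homologyRank (J : Ideal (MvPolynomial σ K)) (i m : ℤ) : ℕ :=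
  Module.finrank K (GradedHomology K (X : σ → MvPolynomial σ K) (quotientGrading J) i m)

theorem koszulChains_eq (J : Ideal (MvPolynomial σ K)) (i m : ℕ) :
    koszulChains J i m = gradedChains K (quotientGrading J) i m := by
  unfold koszulChains gradedChains
  congr 1
  funext A
  by_cases hA : A.card = i
  · by_cases hm : i ≤ m
    · rw [if_pos ⟨hA, hm⟩, if_pos (by exact_mod_cast hA), ← Nat.cast_sub hm,
        quotientGrading_natCast]
    · rw [if_neg (by tauto), if_pos (by exact_mod_cast hA), quotientGrading_of_neg]
      omega
  · rw [if_neg (by tauto), if_neg (by exact_mod_cast hA)]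

theorem koszulD_eq (J : Ideal (MvPolynomial σ K)) :
    koszulD J = moduleKoszulD K (X : σ → MvPolynomial σ K) := rfl

theorem betti_eq_homologyRank (J : Ideal (MvPolynomial σ K)) (i m : ℕ) :
    betti J i m = homologyRank J i m := by
  have h1 : koszulCycles J i m
      = gradedCycles K (X : σ → MvPolynomial σ K) (quotientGrading J) i m := by
    rw [koszulCycles, gradedCycles, koszulChains_eq, koszulD_eq]
  have h2 : koszulBoundaries J i m
      = gradedBoundaries K (X : σ → MvPolynomial σ K) (quotientGrading J) i m := by
    rw [koszulBoundaries, gradedBoundaries, koszulChains_eq, koszulD_eq]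
    push_cast
    rfl
  unfold betti homologyRank GradedHomology
  rw [h1, h2]

theorem homologyRank_eq_zero {J : Ideal (MvPolynomial σ K)} {i m : ℤ}
    (h : IsExactAt K (X : σ → MvPolynomial σ K) (quotientGrading J) i m) :
    homologyRank J i m = 0 := by
  unfold homologyRank GradedHomology
  rw [Submodule.submoduleOf_eq_top.2 h]
  exact Module.finrank_zero_of_subsingleton

theorem homologyRank_eq_zero_of_forall {J : Ideal (MvPolynomial σ K)} {i m : ℤ}
    (h : ∀ f ∈ gradedChains (σ := σ) K (quotientGrading J) i m, f = 0) :
    homologyRank J i m = 0 := by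
  refine homologyRank_eq_zero fun f hf => ?_
  rw [h f hf.1]
  exact zero_mem _

theorem homologyRank_eq_zero_of_neg (J : Ideal (MvPolynomial σ K)) {i m : ℤ} (hi : i < 0) :
    homologyRank J i m = 0 :=
  homologyRank_eq_zero_of_forall fun f hf => funext fun A =>
    eq_zero_of_mem_gradedChains hf (by omega)

theorem homologyRank_eq_zero_of_lt (J : Ideal (MvPolynomial σ K)) {i m : ℤ} (hi : m < i) :
    homologyRank J i m = 0 :=
  homologyRank_eq_zero_of_forall fun f hf => funext fun A => by
    have := apply_mem_of_mem_gradedChains hf A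
    rwa [quotientGrading_of_neg _ (by omega), Submodule.mem_bot] at this

namespace RegularReduction

theorem le {J A : Ideal (MvPolynomial σ K)} {c E : ℕ} (h : RegularReduction J A c E) : c ≤ E := by
  induction h with
  | refl => exact le_rfl
  | step he _ _ _ ih => omega

theorem isExactAt {J A : Ideal (MvPolynomial σ K)} {c E : ℕ} (h : RegularReduction J A c E)
    (hJ : J.IsHomogeneous (homogeneousSubmodule σ K)) {i m : ℤ}
    (hA : IsExactAt K (X : σ → MvPolynomial σ K) (quotientGrading A) (i + c) (m + E)) :
    IsExactAt K (X : σ → MvPolynomial σ K) (quotientGrading J) i m := by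
  induction h generalizing i m with
  | refl => simpa using hA
  | @step J A θ e c E he hθ hreg _ ih =>
    obtain ⟨a, step⟩ := exists_regularStep_quotientGrading hJ he hθ hreg
    refine step.isExactAt_of_quotient (ih (isHomogeneous_sup_span hJ hθ) ?_)
    convert hA using 1 <;> push_cast <;> ring

/-- The Koszul homology of `S / J` in its top degree `#σ - c` is, up to a shift of the internal
degree, the top Koszul homology of the reduction. -/
theorem homologyRank_eq {J A : Ideal (MvPolynomial σ K)} {c E : ℕ} (h : RegularReduction J A c E)
    (hJ : J.IsHomogeneous (homogeneousSubmodule σ K)) (m : ℤ) :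
    homologyRank J (Fintype.card σ - c) m = homologyRank A (Fintype.card σ) (m + E) := by
  induction h generalizing m with
  | refl => simp
  | @step J A θ e c E he hθ hreg h ih =>
    obtain ⟨a, step⟩ := exists_regularStep_quotientGrading hJ he hθ hreg
    have hex : IsExactAt K (X : σ → MvPolynomial σ K) (quotientGrading J)
        (((Fintype.card σ : ℤ) - (c + 1 : ℕ)) + 1) (m + e) :=
      (RegularReduction.step he hθ hreg h).isExactAt hJ
        (isExactAt_of_card_lt _ _ (by push_cast; omega))
    have h1 := step.finrank_gradedHomology_eq hex
    have h2 := ih (isHomogeneous_sup_span hJ hθ) (m + e)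
    rw [show (Fintype.card σ : ℤ) - c = ((Fintype.card σ : ℤ) - (c + 1 : ℕ)) + 1 by push_cast; ring,
      show m + e + E = m + ((E + e : ℕ) : ℤ) by push_cast; ring] at h2
    exact h1.trans h2

end RegularReduction

/-- The socle of `S / A`: the elements killed by all variables. -/
def socle (A : Ideal (MvPolynomial σ K)) : Submodule K (MvPolynomial σ K ⧸ A) where
  carrier := {y | ∀ v, (X v : MvPolynomial σ K) • y = 0}
  add_mem' hy hz v := by rw [smul_add, hy v, hz v, add_zero]
  zero_mem' v := smul_zero _
  smul_mem' c y hy v := by rw [smul_comm, hy v, smul_zero]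

/-- The top Koszul homology of `S / A` is its socle. -/
theorem homologyRank_card (A : Ideal (MvPolynomial σ K)) (m : ℤ) :
    homologyRank A (Fintype.card σ) m
      = Module.finrank K ↥(socle A ⊓ quotientGrading A (m - Fintype.card σ)) := by
  set n : ℤ := ((Fintype.card σ : ℕ) : ℤ) with hn
  have hbot : (gradedBoundaries K (X : σ → MvPolynomial σ K) (quotientGrading A) n m).submoduleOf
      (gradedCycles K (X : σ → MvPolynomial σ K) (quotientGrading A) n m) = ⊥ := by
    rw [eq_bot_iff]
    rintro f ⟨g, hg, hgf⟩
    rw [eq_zero_of_mem_gradedChains_of_card_lt (by omega) hg, map_zero] at hgf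
    rw [Submodule.mem_bot]
    exact Subtype.ext hgf.symm
  let φ : gradedCycles K (X : σ → MvPolynomial σ K) (quotientGrading A) n m →ₗ[K]
      ↥(socle A ⊓ quotientGrading A (m - n)) :=
    ((LinearMap.proj Finset.univ).comp (Submodule.subtype _)).codRestrict _ (by
      rintro ⟨f, hf, hdf⟩
      refine ⟨?_, apply_mem_of_mem_gradedChains hf _⟩
      have hdf' : moduleKoszulD K (X : σ → MvPolynomial σ K) f = 0 := hdf
      rw [eq_topChain hf, moduleKoszulD_topChain_eq_zero_iff] at hdf'
      exact hdf')
  have hφ : Function.Bijective φ := by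
    constructor
    · rintro ⟨f, hf⟩ ⟨g, hg⟩ hfg
      have : f Finset.univ = g Finset.univ := congrArg Subtype.val hfg
      refine Subtype.ext ?_
      change f = g
      rw [eq_topChain hf.1, eq_topChain hg.1, this]
    · rintro ⟨y, hy, hyD⟩
      refine ⟨⟨topChain σ y, topChain_mem hyD,
        (moduleKoszulD_topChain_eq_zero_iff (K := K) _ y).2 hy⟩, Subtype.ext ?_⟩
      change topChain σ y Finset.univ = y
      simp [topChain]
  exact ((Submodule.quotEquivOfEqBot _ hbot).trans (LinearEquiv.ofBijective φ hφ)).finrank_eq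

/-- `s` is the largest degree in which `S / A` does not vanish. -/
def IsTopDegree (A : Ideal (MvPolynomial σ K)) (s : ℕ) : Prop :=
  degreePart A s ≠ ⊥ ∧ ∀ j, s < j → degreePart A j = ⊥

theorem exists_isTopDegree {A : Ideal (MvPolynomial σ K)} (hA : A ≠ ⊤)
    (hrad : ∀ v, X v ∈ A.radical) : ∃ s, IsTopDegree A s := by
  classical
  obtain ⟨N, hN⟩ := Ideal.exists_pow_le_of_le_radical_of_fg
    (show idealOfVars σ K ≤ A.radical from
      Ideal.span_le.2 (by rintro _ ⟨v, rfl⟩; exact hrad v)) (idealOfVars_fg σ K)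
  have hvan : ∀ j, N ≤ j → degreePart A j = ⊥ := by
    intro j hj
    rw [eq_bot_iff]
    rintro y hy
    obtain ⟨p, hp, rfl⟩ := mem_degreePart.1 hy
    rw [Submodule.mem_bot, Ideal.Quotient.eq_zero_iff_mem]
    refine hN ((mem_pow_idealOfVars_iff' N p).2 fun x hx => hp.coeff_eq_zero (by omega))
  have h0 : degreePart A 0 ≠ ⊥ := by
    intro h
    have h1 : Ideal.Quotient.mk A 1 ∈ degreePart A 0 :=
      mem_degreePart.2 ⟨1, isHomogeneous_one _ _, rfl⟩
    rw [h, Submodule.mem_bot, Ideal.Quotient.eq_zero_iff_mem] at h1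
    exact hA ((Ideal.eq_top_iff_one A).2 h1)
  refine ⟨Nat.findGreatest (fun j => degreePart A j ≠ ⊥) N,
    Nat.findGreatest_spec (P := fun j => degreePart A j ≠ ⊥) (Nat.zero_le N) h0, fun j hj => ?_⟩
  rcases le_total N j with h | h
  · exact hvan j h
  · exact not_not.1 (Nat.findGreatest_is_greatest hj h)

instance finite_degreePart (A : Ideal (MvPolynomial σ K)) (j : ℕ) :
    Module.Finite K (degreePart A j) := by
  have : Module.Finite K (homogeneousSubmodule σ K j) :=
    Module.Finite.iff_fg.2 (homogeneousSubmodule_fg σ K j)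
  exact Module.Finite.map _ _

theorem finrank_degreePart_ne_zero {A : Ideal (MvPolynomial σ K)} {s : ℕ}
    (hs : IsTopDegree A s) : Module.finrank K (degreePart A s) ≠ 0 := by
  rw [Ne, Submodule.finrank_eq_zero]
  exact hs.1

theorem quotientGrading_eq_bot {A : Ideal (MvPolynomial σ K)} {s : ℕ} (hs : IsTopDegree A s)
    {j : ℤ} (hj : s < j) : quotientGrading A j = ⊥ := by
  lift j to ℕ using by omega
  rw [quotientGrading_natCast, hs.2 j (by omega)]

theorem degreePart_le_socle {A : Ideal (MvPolynomial σ K)} {s : ℕ} (hs : IsTopDegree A s) :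
    degreePart A s ≤ socle A := by
  intro y hy v
  rw [← quotientGrading_natCast] at hy
  have := smul_mem_quotientGrading (isHomogeneous_X K v) rfl hy
  rwa [quotientGrading_eq_bot hs (by simp), Submodule.mem_bot] at this

theorem finrank_socle_eq_sum {A : Ideal (MvPolynomial σ K)}
    (hA : A.IsHomogeneous (homogeneousSubmodule σ K)) {s : ℕ} (hs : IsTopDegree A s) :
    Module.finrank K (socle A)
      = ∑ t ∈ Finset.range (s + 1), Module.finrank K ↥(socle A ⊓ degreePart A t) := by
  have hfin : ∀ t, Module.Finite K ↥(socle A ⊓ degreePart A t) := fun t =>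
    Module.Finite.of_injective _ (Submodule.inclusion_injective
      (inf_le_right : socle A ⊓ degreePart A t ≤ degreePart A t))
  let φ : ((t : Fin (s + 1)) → ↥(socle A ⊓ degreePart A t)) →ₗ[K] socle A :=
    ∑ t, (Submodule.inclusion inf_le_left).comp (LinearMap.proj t)
  have hφv : ∀ w, (φ w : MvPolynomial σ K ⧸ A) = ∑ t, (w t : MvPolynomial σ K ⧸ A) := by
    intro w
    simp [φ]
  have hφ : Function.Bijective φ := by
    constructor
    · rw [injective_iff_map_eq_zero]
      intro w hw
      have h0 : ∑ t, (w t : MvPolynomial σ K ⧸ A) = 0 := by rw [← hφv, hw]; rfl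
      have hex : ∀ t : Fin (s + 1), ∃ q : MvPolynomial σ K, q.IsHomogeneous t ∧
          Ideal.Quotient.mk A q = w t := fun t => mem_degreePart.1 (w t).2.2
      choose q hq hqw using hex
      have hmem : ∑ t, q t ∈ A := by
        rw [← Ideal.Quotient.eq_zero_iff_mem, map_sum, ← h0]
        exact Finset.sum_congr rfl fun t _ => hqw t
      funext t
      refine Subtype.ext ?_
      change (w t : MvPolynomial σ K ⧸ A) = 0
      rw [← hqw, Ideal.Quotient.eq_zero_iff_mem]
      have := homogeneousComponent_mem_of_mem hA hmem t
      rw [map_sum, Finset.sum_eq_single t] at this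
      · rwa [homogeneousComponent_eq_self (hq t)] at this
      · intro u _ hut
        rw [homogeneousComponent_of_mem (hq u), if_neg]
        intro h
        exact hut (Fin.ext h.symm)
      · simp
    · rintro ⟨y, hy⟩
      obtain ⟨p, rfl⟩ := Ideal.Quotient.mk_surjective y
      have hsoc : ∀ t, Ideal.Quotient.mk A (homogeneousComponent t p) ∈ socle A := by
        intro t v
        have h1 : p * X v ∈ A := by
          rw [mul_comm, ← Ideal.Quotient.eq_zero_iff_mem]
          exact hy v
        have h2 := homogeneousComponent_mem_of_mem hA h1 (t + 1)
        rw [homogeneousComponent_mul_of_isHomogeneous (isHomogeneous_X K v),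
          if_pos (Nat.le_add_left 1 t), Nat.add_sub_cancel, mul_comm] at h2
        exact Ideal.Quotient.eq_zero_iff_mem.2 h2
      refine ⟨fun t => ⟨Ideal.Quotient.mk A (homogeneousComponent t p), hsoc t,
        mem_degreePart.2 ⟨_, homogeneousComponent_isHomogeneous _ _, rfl⟩⟩, Subtype.ext ?_⟩
      rw [hφv]
      change ∑ t : Fin (s + 1), Ideal.Quotient.mk A (homogeneousComponent t p)
        = Ideal.Quotient.mk A p
      rw [Fin.sum_univ_eq_sum_range
        (fun t => Ideal.Quotient.mk A (homogeneousComponent t p)) (s + 1)]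
      conv_rhs => rw [← sum_homogeneousComponent p, map_sum]
      -- Both sums agree with the sum over any range that contains the two.
      have hvan : ∀ t, s < t → Ideal.Quotient.mk A (homogeneousComponent t p) = 0 := by
        intro t ht
        have : Ideal.Quotient.mk A (homogeneousComponent t p) ∈ degreePart A t :=
          mem_degreePart.2 ⟨_, homogeneousComponent_isHomogeneous _ _, rfl⟩
        rwa [hs.2 t ht, Submodule.mem_bot] at this
      rcases le_total s p.totalDegree with h | h
      · refine Finset.sum_subset (Finset.range_subset_range.2 (by omega)) fun t _ ht => hvan t ?_
        simpa using ht
      · refine (Finset.sum_subset (Finset.range_subset_range.2 (by omega)) fun t _ ht => ?_).symm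
        rw [homogeneousComponent_eq_zero _ _ (by simpa using ht), map_zero]
  rw [← (LinearEquiv.ofBijective φ hφ).finrank_eq, Module.finrank_pi_fintype,
    Fin.sum_univ_eq_sum_range (fun t => Module.finrank K ↥(socle A ⊓ degreePart A t)) (s + 1)]

/-! ### The corner of the Betti table -/

/-- The Betti table of `S / J` is contained in the rectangle with the corner `(p, r)`, and its
entry at this corner is not zero. -/
structure HasCorner (J : Ideal (MvPolynomial σ K)) (p r : ℕ) : Prop where
  le_left : ∀ i m, betti J i m ≠ 0 → i ≤ p
  le_right : ∀ i m, betti J i m ≠ 0 → m ≤ i + r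
  ne_zero : betti J p (p + r) ≠ 0

namespace HasCorner

variable {J : Ideal (MvPolynomial σ K)} {p r : ℕ} (h : HasCorner J p r)
include h

theorem projDim_eq : projDim J = p :=
  IsGreatest.csSup_eq ⟨⟨_, h.ne_zero⟩, fun _ ⟨m, hm⟩ => h.le_left _ m hm⟩

theorem reg_eq : reg J = r :=
  IsGreatest.csSup_eq ⟨⟨_, h.ne_zero⟩, fun _ ⟨i, hi⟩ => by
    have := h.le_right _ _ hi
    omega⟩

theorem isExtremal_iff (q : ℕ × ℕ) : IsExtremal J q.1 q.2 ↔ q = (p, r) := by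
  constructor
  · rintro ⟨hne, hq⟩
    by_contra hqp
    have := h.le_right _ _ hne
    exact h.ne_zero (hq p r (fun e => hqp e.symm) (h.le_left _ _ hne) (by omega))
  · rintro rfl
    refine ⟨h.ne_zero, fun k l hkl hk hl => ?_⟩
    by_contra hne
    have h1 := h.le_left _ _ hne
    have h2 := h.le_right _ _ hne
    dsimp only at hk hl
    exact hkl (Prod.ext (by dsimp only; omega) (by dsimp only; omega))

theorem hasUniqueExtremal : HasUniqueExtremal J :=
  ⟨(p, r), (h.isExtremal_iff _).2 rfl, fun q hq => (h.isExtremal_iff q).1 hq⟩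

theorem uniqueExtremal_eq : uniqueExtremal J = betti J p (p + r) := by
  unfold uniqueExtremal
  rw [dif_pos h.hasUniqueExtremal]
  have := (h.isExtremal_iff _).1 h.hasUniqueExtremal.choose_spec.1
  rw [this]

end HasCorner

/-- Let `A` be a reduction of `J` with top degree `s`. Then the Betti table of `S / J` has a corner,
its last column consists of the dimensions of the graded components of the socle of `S / A`, and
the corner corresponds to the component of degree `s`. -/
theorem RegularReduction.exists_hasCorner {J A : Ideal (MvPolynomial σ K)} {c E s : ℕ}
    (h : RegularReduction J A c E) (hJ : J.IsHomogeneous (homogeneousSubmodule σ K))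
    (hA : A.IsHomogeneous (homogeneousSubmodule σ K)) (hs : IsTopDegree A s) :
    ∃ p r, HasCorner J p r ∧ cmType J = Module.finrank K (socle A) ∧
      betti J p (p + r) = Module.finrank K (degreePart A s) := by
  set n := Fintype.card σ with hn
  have hcE := h.le
  have hrank : ∀ t : ℤ, homologyRank J ((n : ℤ) - c) (n + t - E)
      = Module.finrank K ↥(socle A ⊓ quotientGrading A t) := by
    intro t
    rw [h.homologyRank_eq hJ, homologyRank_card, ← hn,
      show (n : ℤ) + t - E + E - n = t by ring]
  have htop : homologyRank J ((n : ℤ) - c) (n + s - E) = Module.finrank K (degreePart A s) := by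
    rw [hrank, quotientGrading_natCast, inf_eq_right.2 (degreePart_le_socle hs)]
  have hne := finrank_degreePart_ne_zero hs
  -- The homology at the corner does not vanish, so the corner lies in the first quadrant.
  have hp : 0 ≤ (n : ℤ) - c := by
    by_contra hneg
    rw [← htop, homologyRank_eq_zero_of_neg J (by omega)] at hne
    exact hne rfl
  have hr : 0 ≤ (s : ℤ) - E + c := by
    by_contra hneg
    rw [← htop, homologyRank_eq_zero_of_lt J (by omega)] at hne
    exact hne rfl
  obtain ⟨p, hp⟩ := Int.eq_ofNat_of_zero_le hp
  obtain ⟨r, hr⟩ := Int.eq_ofNat_of_zero_le hr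
  have hcorner : betti J p (p + r) = Module.finrank K (degreePart A s) := by
    rw [betti_eq_homologyRank, ← htop, hp]
    congr 1
    push_cast
    omega
  have hC : HasCorner J p r := by
    refine ⟨fun i m him => ?_, fun i m him => ?_, by rwa [hcorner]⟩
    · by_contra hi
      rw [betti_eq_homologyRank] at him
      exact him (homologyRank_eq_zero (h.isExactAt hJ (isExactAt_of_card_lt _ _ (by omega))))
    · by_contra hm
      rw [betti_eq_homologyRank] at him
      refine him (homologyRank_eq_zero (h.isExactAt hJ fun f hf => ?_))
      have : f = 0 := funext fun B => by
        have := apply_mem_of_mem_gradedChains hf.1 B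
        rwa [quotientGrading_eq_bot hs (by omega), Submodule.mem_bot] at this
      rw [this]
      exact zero_mem _
  refine ⟨p, r, hC, ?_, hcorner⟩
  have hsr : s + 1 = (E - c) + (r + 1) := by omega
  rw [finrank_socle_eq_sum hA hs, hsr, Finset.sum_range_add, Finset.sum_eq_zero, zero_add, cmType,
    hC.projDim_eq, hC.reg_eq]
  · refine Finset.sum_congr rfl fun j _ => ?_
    rw [betti_eq_homologyRank, ← quotientGrading_natCast, ← hrank, hp]
    congr 1
    push_cast [Nat.cast_sub hcE]
    omega
  -- In degrees below `E - c` the socle of `S / A` vanishes.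
  · intro t ht
    rw [Finset.mem_range] at ht
    rw [← quotientGrading_natCast, ← hrank, homologyRank_eq_zero_of_lt J (by omega)]

end Betti

/-! ### Ideals in disjoint sets of variables -/

section JointKernel

open TensorProduct

variable {K U W ι : Type*} [Field K] [AddCommGroup U] [Module K U] [AddCommGroup W] [Module K W]

theorem mem_range_rTensor_of_forall {N : Submodule K U} (f : ι → U →ₗ[K] U)
    (hN : ∀ y, (∀ i, f i y = 0) → y ∈ N) {t : U ⊗[K] W} (ht : ∀ i, (f i).rTensor W t = 0) :
    t ∈ LinearMap.range (N.subtype.rTensor W) := by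
  let 𝒞 := Module.Basis.ofVectorSpace K W
  obtain ⟨b, rfl⟩ := TensorProduct.eq_repr_basis_right 𝒞 t
  have hb : ∀ k, b k ∈ N := by
    intro k
    refine hN _ fun i => ?_
    have h0 := ht i
    have h1 : (b.mapRange (f i) (map_zero _)).sum (fun k m => m ⊗ₜ[K] 𝒞 k) = 0 := by
      rw [Finsupp.sum_mapRange_index (by simp)]
      simpa [Finsupp.sum] using h0
    have h2 := TensorProduct.sum_tmul_basis_right_eq_zero 𝒞 _ h1
    simpa using DFunLike.congr_fun h2 k
  exact Submodule.sum_mem _ fun k _ => ⟨⟨b k, hb k⟩ ⊗ₜ 𝒞 k, rfl⟩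

theorem mem_range_lTensor_of_forall {N : Submodule K W} (f : ι → W →ₗ[K] W)
    (hN : ∀ y, (∀ i, f i y = 0) → y ∈ N) {t : U ⊗[K] W} (ht : ∀ i, (f i).lTensor U t = 0) :
    t ∈ LinearMap.range (N.subtype.lTensor U) := by
  let 𝒞 := Module.Basis.ofVectorSpace K U
  obtain ⟨b, rfl⟩ := TensorProduct.eq_repr_basis_left 𝒞 t
  have hb : ∀ k, b k ∈ N := by
    intro k
    refine hN _ fun i => ?_
    have h0 := ht i
    have h1 : (b.mapRange (f i) (map_zero _)).sum (fun k m => 𝒞 k ⊗ₜ[K] m) = 0 := by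
      rw [Finsupp.sum_mapRange_index (by simp)]
      simpa [Finsupp.sum] using h0
    have h2 := TensorProduct.sum_tmul_basis_left_eq_zero 𝒞 _ h1
    simpa using DFunLike.congr_fun h2 k
  exact Submodule.sum_mem _ fun k _ => ⟨𝒞 k ⊗ₜ ⟨b k, hb k⟩, rfl⟩

/-- An element of `U ⊗ W` that is killed by all `f i ⊗ 1` and all `1 ⊗ g j` lies in `N ⊗ P`, where
`N` and `P` are the joint kernels of the `f i` and of the `g j`. -/
theorem mem_range_mapIncl_of_forall {κ : Type*} {N : Submodule K U} {P : Submodule K W}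
    (f : ι → U →ₗ[K] U) (g : κ → W →ₗ[K] W)
    (hN : ∀ y, (∀ i, f i y = 0) → y ∈ N) (hP : ∀ y, (∀ j, g j y = 0) → y ∈ P) {t : U ⊗[K] W}
    (hf : ∀ i, (f i).rTensor W t = 0) (hg : ∀ j, (g j).lTensor U t = 0) :
    t ∈ LinearMap.range (TensorProduct.mapIncl N P) := by
  obtain ⟨t, rfl⟩ := mem_range_rTensor_of_forall f hN hf
  have hinj := Module.Flat.rTensor_preserves_injective_linearMap (M := W) N.subtype
    N.subtype_injective
  obtain ⟨u, rfl⟩ : t ∈ LinearMap.range (P.subtype.lTensor N) := by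
    refine mem_range_lTensor_of_forall g hP fun j => hinj ?_
    rw [map_zero, ← hg j, ← LinearMap.comp_apply, ← LinearMap.comp_apply,
      LinearMap.rTensor_comp_lTensor, LinearMap.lTensor_comp_rTensor]
  refine ⟨u, ?_⟩
  rw [← LinearMap.comp_apply, LinearMap.rTensor_comp_lTensor]

theorem tmul_one_mul {B C : Type*} [CommRing B] [Algebra K B] [CommRing C] [Algebra K C] (b : B)
    (t : B ⊗[K] C) : (b ⊗ₜ[K] 1) * t = (LinearMap.mulLeft K b).rTensor C t := by
  induction t using TensorProduct.induction_on with
  | zero => simp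
  | tmul x y => simp
  | add x y hx hy => rw [mul_add, hx, hy, map_add]

theorem one_tmul_mul {B C : Type*} [CommRing B] [Algebra K B] [CommRing C] [Algebra K C] (c : C)
    (t : B ⊗[K] C) : (1 ⊗ₜ[K] c) * t = (LinearMap.mulLeft K c).lTensor B t := by
  induction t using TensorProduct.induction_on with
  | zero => simp
  | tmul x y => simp
  | add x y hx hy => rw [mul_add, hx, hy, map_add]

end JointKernel

section DisjointSum

open TensorProduct

attribute [local instance] MvPolynomial.gradedAlgebra

variable {K σ₁ σ₂ τ : Type*} [Field K]

/-- The ideal of `K[τ]` generated by an ideal `J₁` in the variables `σ₁` and an ideal `J₂` in the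
variables `σ₂`, where `e` identifies `τ` with the disjoint union of `σ₁` and `σ₂`. -/
def disjointSum (e : σ₁ ⊕ σ₂ ≃ τ) (J₁ : Ideal (MvPolynomial σ₁ K))
    (J₂ : Ideal (MvPolynomial σ₂ K)) : Ideal (MvPolynomial τ K) :=
  J₁.map (rename (e ∘ Sum.inl) : MvPolynomial σ₁ K →ₐ[K] MvPolynomial τ K) ⊔
    J₂.map (rename (e ∘ Sum.inr) : MvPolynomial σ₂ K →ₐ[K] MvPolynomial τ K)

variable (e : σ₁ ⊕ σ₂ ≃ τ) (J₁ A₁ : Ideal (MvPolynomial σ₁ K)) (J₂ A₂ : Ideal (MvPolynomial σ₂ K))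

theorem disjointSum_comm :
    disjointSum e J₁ J₂ = disjointSum ((Equiv.sumComm σ₂ σ₁).trans e) J₂ J₁ :=
  sup_comm _ _

theorem rename_inl_mem {p : MvPolynomial σ₁ K} (hp : p ∈ J₁) :
    rename (e ∘ Sum.inl) p ∈ disjointSum e J₁ J₂ :=
  Ideal.mem_sup_left (Ideal.mem_map_of_mem _ hp)

theorem rename_inr_mem {p : MvPolynomial σ₂ K} (hp : p ∈ J₂) :
    rename (e ∘ Sum.inr) p ∈ disjointSum e J₁ J₂ :=
  Ideal.mem_sup_right (Ideal.mem_map_of_mem _ hp)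

/-- The homomorphism from `K[τ]` to the tensor product of the two quotients. -/
def toTensor : MvPolynomial τ K →ₐ[K] (MvPolynomial σ₁ K ⧸ J₁) ⊗[K] (MvPolynomial σ₂ K ⧸ J₂) :=
  aeval fun t => Sum.elim (fun v => Ideal.Quotient.mk J₁ (X v) ⊗ₜ[K] 1)
    (fun w => 1 ⊗ₜ[K] Ideal.Quotient.mk J₂ (X w)) (e.symm t)

theorem toTensor_rename_inl (p : MvPolynomial σ₁ K) :
    toTensor e J₁ J₂ (rename (e ∘ Sum.inl) p) = Ideal.Quotient.mk J₁ p ⊗ₜ[K] 1 := by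
  have : (toTensor e J₁ J₂).comp (rename (e ∘ Sum.inl))
      = Algebra.TensorProduct.includeLeft.comp (Ideal.Quotient.mkₐ K J₁) := by
    ext v
    simp [toTensor]
  exact DFunLike.congr_fun this p

theorem toTensor_rename_inr (p : MvPolynomial σ₂ K) :
    toTensor e J₁ J₂ (rename (e ∘ Sum.inr) p) = 1 ⊗ₜ[K] Ideal.Quotient.mk J₂ p := by
  have : (toTensor e J₁ J₂).comp (rename (e ∘ Sum.inr))
      = Algebra.TensorProduct.includeRight.comp (Ideal.Quotient.mkₐ K J₂) := by
    ext v
    simp [toTensor]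
  exact DFunLike.congr_fun this p

theorem toTensor_eq_zero {p : MvPolynomial τ K} (hp : p ∈ disjointSum e J₁ J₂) :
    toTensor e J₁ J₂ p = 0 := by
  have : disjointSum e J₁ J₂ ≤ RingHom.ker (toTensor e J₁ J₂) := by
    refine sup_le (Ideal.map_le_iff_le_comap.2 fun q hq => ?_)
      (Ideal.map_le_iff_le_comap.2 fun q hq => ?_)
    · rw [Ideal.mem_comap, RingHom.mem_ker]
      exact (toTensor_rename_inl e J₁ J₂ q).trans
        (by rw [Ideal.Quotient.eq_zero_iff_mem.2 hq, zero_tmul])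
    · rw [Ideal.mem_comap, RingHom.mem_ker]
      exact (toTensor_rename_inr e J₁ J₂ q).trans
        (by rw [Ideal.Quotient.eq_zero_iff_mem.2 hq, tmul_zero])
  exact this hp

/-- The homomorphism from the quotient by the sum to the tensor product of the quotients. -/
def quotientToTensor : (MvPolynomial τ K ⧸ disjointSum e J₁ J₂) →ₐ[K]
    (MvPolynomial σ₁ K ⧸ J₁) ⊗[K] (MvPolynomial σ₂ K ⧸ J₂) :=
  Ideal.Quotient.liftₐ _ (toTensor e J₁ J₂) fun _ hp => toTensor_eq_zero e J₁ J₂ hp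

/-- The inverse of `quotientToTensor`. -/
def fromTensor : (MvPolynomial σ₁ K ⧸ J₁) ⊗[K] (MvPolynomial σ₂ K ⧸ J₂) →ₐ[K]
    (MvPolynomial τ K ⧸ disjointSum e J₁ J₂) :=
  Algebra.TensorProduct.productMap
    (Ideal.Quotient.liftₐ J₁ ((Ideal.Quotient.mkₐ K _).comp (rename (e ∘ Sum.inl)))
      fun _ hp => Ideal.Quotient.eq_zero_iff_mem.2 (rename_inl_mem e J₁ J₂ hp))
    (Ideal.Quotient.liftₐ J₂ ((Ideal.Quotient.mkₐ K _).comp (rename (e ∘ Sum.inr)))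
      fun _ hp => Ideal.Quotient.eq_zero_iff_mem.2 (rename_inr_mem e J₁ J₂ hp))

theorem fromTensor_tmul_one (p : MvPolynomial σ₁ K) :
    fromTensor e J₁ J₂ (Ideal.Quotient.mk J₁ p ⊗ₜ[K] 1)
      = Ideal.Quotient.mk _ (rename (e ∘ Sum.inl) p) :=
  Algebra.TensorProduct.productMap_left_apply _ _ _

theorem fromTensor_one_tmul (p : MvPolynomial σ₂ K) :
    fromTensor e J₁ J₂ (1 ⊗ₜ[K] Ideal.Quotient.mk J₂ p)
      = Ideal.Quotient.mk _ (rename (e ∘ Sum.inr) p) :=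
  Algebra.TensorProduct.productMap_right_apply _ _ _

/-- The quotient by a sum of ideals in disjoint sets of variables is the tensor product of the two
quotients. -/
def tensorEquiv : (MvPolynomial τ K ⧸ disjointSum e J₁ J₂) ≃ₐ[K]
    (MvPolynomial σ₁ K ⧸ J₁) ⊗[K] (MvPolynomial σ₂ K ⧸ J₂) :=
  AlgEquiv.ofAlgHom
    (quotientToTensor e J₁ J₂) (fromTensor e J₁ J₂)
    (by
      refine Algebra.TensorProduct.ext ?_ ?_
      · refine Ideal.Quotient.algHom_ext _ (MvPolynomial.algHom_ext fun v => ?_)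
        exact (congrArg (quotientToTensor e J₁ J₂) (fromTensor_tmul_one e J₁ J₂ (X v))).trans
          (toTensor_rename_inl e J₁ J₂ (X v))
      · refine Ideal.Quotient.algHom_ext _ (MvPolynomial.algHom_ext fun w => ?_)
        exact (congrArg (quotientToTensor e J₁ J₂) (fromTensor_one_tmul e J₁ J₂ (X w))).trans
          (toTensor_rename_inr e J₁ J₂ (X w)))
    (by
      refine Ideal.Quotient.algHom_ext _ (MvPolynomial.algHom_ext fun t => ?_)
      obtain ⟨v | w, rfl⟩ := e.surjective t
      · have := toTensor_rename_inl e J₁ J₂ (X v)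
        have h2 := fromTensor_tmul_one e J₁ J₂ (X v)
        rw [rename_X] at this h2
        exact (congrArg (fromTensor e J₁ J₂) this).trans h2
      · have := toTensor_rename_inr e J₁ J₂ (X w)
        have h2 := fromTensor_one_tmul e J₁ J₂ (X w)
        rw [rename_X] at this h2
        exact (congrArg (fromTensor e J₁ J₂) this).trans h2)

theorem tensorEquiv_mk (p : MvPolynomial τ K) :
    tensorEquiv e J₁ J₂ (Ideal.Quotient.mk _ p) = toTensor e J₁ J₂ p := rfl

theorem tensorEquiv_rename_inl_smul (p : MvPolynomial σ₁ K)
    (y : MvPolynomial τ K ⧸ disjointSum e J₁ J₂) :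
    tensorEquiv e J₁ J₂ (rename (e ∘ Sum.inl) p • y)
      = (LinearMap.mulLeft K (Ideal.Quotient.mk J₁ p)).rTensor _ (tensorEquiv e J₁ J₂ y) := by
  have h1 : tensorEquiv e J₁ J₂ (rename (e ∘ Sum.inl) p • y)
      = (Ideal.Quotient.mk J₁ p ⊗ₜ[K] 1) * tensorEquiv e J₁ J₂ y := by
    rw [← toTensor_rename_inl e J₁ J₂, ← tensorEquiv_mk, ← map_mul]
    rfl
  exact h1.trans (tmul_one_mul _ _)

theorem tensorEquiv_rename_inr_smul (p : MvPolynomial σ₂ K)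
    (y : MvPolynomial τ K ⧸ disjointSum e J₁ J₂) :
    tensorEquiv e J₁ J₂ (rename (e ∘ Sum.inr) p • y)
      = (LinearMap.mulLeft K (Ideal.Quotient.mk J₂ p)).lTensor _ (tensorEquiv e J₁ J₂ y) := by
  have h1 : tensorEquiv e J₁ J₂ (rename (e ∘ Sum.inr) p • y)
      = (1 ⊗ₜ[K] Ideal.Quotient.mk J₂ p) * tensorEquiv e J₁ J₂ y := by
    rw [← toTensor_rename_inr e J₁ J₂, ← tensorEquiv_mk, ← map_mul]
    rfl
  exact h1.trans (one_tmul_mul _ _)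

theorem isSMulRegular_rename_inl {θ : MvPolynomial σ₁ K}
    (hθ : IsSMulRegular (MvPolynomial σ₁ K ⧸ J₁) θ) :
    IsSMulRegular (MvPolynomial τ K ⧸ disjointSum e J₁ J₂)
      (rename (e ∘ Sum.inl) θ : MvPolynomial τ K) := by
  intro y z hyz
  have hinj := Module.Flat.rTensor_preserves_injective_linearMap
    (M := MvPolynomial σ₂ K ⧸ J₂) (LinearMap.mulLeft K (Ideal.Quotient.mk J₁ θ)) hθ
  have := congrArg (tensorEquiv e J₁ J₂) hyz
  dsimp only at this
  rw [tensorEquiv_rename_inl_smul, tensorEquiv_rename_inl_smul] at this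
  exact (tensorEquiv e J₁ J₂).injective (hinj this)

variable {J₁ J₂ A₁ A₂}

theorem isHomogeneous_map_rename {σ : Type*} (f : σ → τ) {J : Ideal (MvPolynomial σ K)}
    (hJ : J.IsHomogeneous (homogeneousSubmodule σ K)) :
    (J.map (rename f : MvPolynomial σ K →ₐ[K] MvPolynomial τ K)).IsHomogeneous
      (homogeneousSubmodule τ K) := by
  rw [Ideal.IsHomogeneous.iff_exists] at hJ
  obtain ⟨S, rfl⟩ := hJ
  rw [Ideal.map_span]
  refine Ideal.homogeneous_span _ _ ?_
  rintro _ ⟨_, ⟨⟨p, j, hp⟩, -, rfl⟩, rfl⟩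
  exact ⟨j, IsHomogeneous.rename_isHomogeneous hp⟩

theorem isHomogeneous_disjointSum (h₁ : J₁.IsHomogeneous (homogeneousSubmodule σ₁ K))
    (h₂ : J₂.IsHomogeneous (homogeneousSubmodule σ₂ K)) :
    (disjointSum e J₁ J₂).IsHomogeneous (homogeneousSubmodule τ K) :=
  (isHomogeneous_map_rename _ h₁).sup (isHomogeneous_map_rename _ h₂)

variable [Fintype σ₁] [Fintype σ₂] [Fintype τ] [DecidableEq σ₁] [DecidableEq σ₂] [DecidableEq τ]

variable (J₂) in
theorem RegularReduction.disjointSum_left {c E : ℕ} (h : RegularReduction J₁ A₁ c E) :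
    RegularReduction (disjointSum e J₁ J₂) (disjointSum e A₁ J₂) c E := by
  induction h with
  | refl J => exact .refl _
  | @step J A θ d c E hd hθ hreg _ ih =>
    refine .step hd (IsHomogeneous.rename_isHomogeneous hθ)
      (isSMulRegular_rename_inl e J J₂ hreg) ?_
    convert ih using 1
    rw [disjointSum, disjointSum, Ideal.map_sup, Ideal.map_span, Set.image_singleton,
      sup_right_comm]

/-- Reductions of two ideals in disjoint sets of variables combine to a reduction of their
sum. -/
theorem RegularReduction.disjointSum {c₁ E₁ c₂ E₂ : ℕ} (h₁ : RegularReduction J₁ A₁ c₁ E₁)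
    (h₂ : RegularReduction J₂ A₂ c₂ E₂) :
    RegularReduction (disjointSum e J₁ J₂) (disjointSum e A₁ A₂) (c₁ + c₂) (E₁ + E₂) := by
  refine (h₁.disjointSum_left e J₂).trans ?_
  rw [disjointSum_comm e A₁ J₂, disjointSum_comm e A₁ A₂]
  exact h₂.disjointSum_left _ A₁

theorem map_tensorEquiv_socle :
    (socle (disjointSum e A₁ A₂)).map (tensorEquiv e A₁ A₂).toLinearEquiv.toLinearMap
      = LinearMap.range (TensorProduct.mapIncl (socle A₁) (socle A₂)) := by
  apply le_antisymm
  · rintro _ ⟨y, hy, rfl⟩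
    refine mem_range_mapIncl_of_forall (N := socle A₁) (P := socle A₂)
      (fun v => LinearMap.mulLeft K (Ideal.Quotient.mk A₁ (X v)))
      (fun w => LinearMap.mulLeft K (Ideal.Quotient.mk A₂ (X w))) (fun _ h => h) (fun _ h => h)
      (fun v => ?_) (fun w => ?_)
    · refine (tensorEquiv_rename_inl_smul e A₁ A₂ (X v) y).symm.trans ?_
      rw [rename_X, hy, map_zero]
    · refine (tensorEquiv_rename_inr_smul e A₁ A₂ (X w) y).symm.trans ?_
      rw [rename_X, hy, map_zero]
  · rintro _ ⟨t, rfl⟩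
    induction t using TensorProduct.induction_on with
    | zero => simp
    | add a b ha hb => rw [map_add]; exact add_mem ha hb
    | tmul a b =>
      refine ⟨(tensorEquiv e A₁ A₂).symm (a.1 ⊗ₜ b.1), fun t => ?_,
        (tensorEquiv e A₁ A₂).apply_symm_apply _⟩
      apply (tensorEquiv e A₁ A₂).injective
      obtain ⟨v | w, rfl⟩ := e.surjective t
      · have := tensorEquiv_rename_inl_smul e A₁ A₂ (X v)
          ((tensorEquiv e A₁ A₂).symm (a.1 ⊗ₜ b.1))
        rw [rename_X] at this
        refine this.trans ?_
        rw [AlgEquiv.apply_symm_apply, map_zero, LinearMap.rTensor_tmul]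
        exact (congrArg (· ⊗ₜ[K] b.1) (a.2 v)).trans (zero_tmul _ _)
      · have := tensorEquiv_rename_inr_smul e A₁ A₂ (X w)
          ((tensorEquiv e A₁ A₂).symm (a.1 ⊗ₜ b.1))
        rw [rename_X] at this
        refine this.trans ?_
        rw [AlgEquiv.apply_symm_apply, map_zero, LinearMap.lTensor_tmul]
        exact (congrArg (a.1 ⊗ₜ[K] ·) (b.2 w)).trans (tmul_zero _ _)

theorem finrank_range_mapIncl {U W : Type*} [AddCommGroup U] [Module K U] [AddCommGroup W]
    [Module K W] (N : Submodule K U) (P : Submodule K W) :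
    Module.finrank K (LinearMap.range (TensorProduct.mapIncl N P))
      = Module.finrank K N * Module.finrank K P := by
  rw [LinearMap.finrank_range_of_inj (Module.Flat.tensorProduct_mapIncl_injective_of_left N P),
    Module.finrank_tensorProduct]

theorem finrank_socle_disjointSum :
    Module.finrank K (socle (disjointSum e A₁ A₂))
      = Module.finrank K (socle A₁) * Module.finrank K (socle A₂) := by
  rw [← finrank_range_mapIncl, ← map_tensorEquiv_socle e]
  exact ((tensorEquiv e A₁ A₂).toLinearEquiv.finrank_map_eq _).symm

/-- A monomial of degree `j` is the product of a monomial of degree `a` in the first variables and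
one of degree `b` in the second variables, `a + b = j`. -/
theorem toTensor_mem_span {p : MvPolynomial τ K} {j : ℕ} (hp : p.IsHomogeneous j) :
    toTensor e A₁ A₂ p ∈ Submodule.span K
      {t | ∃ a b, a + b = j ∧ ∃ y ∈ degreePart A₁ a, ∃ z ∈ degreePart A₂ b, y ⊗ₜ[K] z = t} := by
  rw [p.as_sum, map_sum]
  refine Submodule.sum_mem _ fun d hd => ?_
  have hdj : d.degree = j := by
    by_contra hne
    exact mem_support_iff.1 hd (hp.coeff_eq_zero hne)
  rw [← mul_one (coeff d p), ← smul_eq_mul, ← smul_monomial, map_smul]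
  refine Submodule.smul_mem _ _ (Submodule.subset_span ?_)
  refine ⟨∑ v, d (e (Sum.inl v)), ∑ w, d (e (Sum.inr w)), ?_,
    _, mem_degreePart.2 ⟨∏ v, X v ^ d (e (Sum.inl v)), ?_, rfl⟩,
    _, mem_degreePart.2 ⟨∏ w, X w ^ d (e (Sum.inr w)), ?_, rfl⟩, ?_⟩
  · rw [← hdj, Finsupp.degree_eq_sum, ← Equiv.sum_comp e, Fintype.sum_sum_type]
  · exact IsHomogeneous.prod _ _ _ fun v _ => isHomogeneous_X_pow v _
  · exact IsHomogeneous.prod _ _ _ fun v _ => isHomogeneous_X_pow v _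
  · rw [monomial_eq, C_1, one_mul, Finsupp.prod_fintype _ _ (fun _ => pow_zero _),
      ← Equiv.prod_comp e, Fintype.prod_sum_type, map_mul]
    have h1 := toTensor_rename_inl e A₁ A₂ (∏ v, X v ^ d (e (Sum.inl v)))
    have h2 := toTensor_rename_inr e A₁ A₂ (∏ w, X w ^ d (e (Sum.inr w)))
    simp only [map_prod, map_pow, rename_X, Function.comp_apply] at h1 h2 ⊢
    rw [h1, h2, Algebra.TensorProduct.tmul_mul_tmul, one_mul, mul_one]

variable {s₁ s₂ : ℕ} (hs₁ : IsTopDegree A₁ s₁) (hs₂ : IsTopDegree A₂ s₂)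
include hs₁ hs₂

theorem map_tensorEquiv_degreePart :
    (degreePart (disjointSum e A₁ A₂) (s₁ + s₂)).map
        (tensorEquiv e A₁ A₂).toLinearEquiv.toLinearMap
      = LinearMap.range (TensorProduct.mapIncl (degreePart A₁ s₁) (degreePart A₂ s₂)) := by
  apply le_antisymm
  · rintro _ ⟨_, ⟨p, hp, rfl⟩, rfl⟩
    refine Submodule.span_le.2 ?_ (toTensor_mem_span e hp)
    rintro _ ⟨a, b, hab, y, hy, z, hz, rfl⟩
    rcases lt_trichotomy a s₁ with h | h | h
    · rw [hs₂.2 b (by omega), Submodule.mem_bot] at hz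
      rw [hz, tmul_zero]
      exact zero_mem _
    · subst h
      obtain rfl : b = s₂ := by omega
      exact ⟨⟨y, hy⟩ ⊗ₜ ⟨z, hz⟩, rfl⟩
    · rw [hs₁.2 a h, Submodule.mem_bot] at hy
      rw [hy, zero_tmul]
      exact zero_mem _
  · rintro _ ⟨t, rfl⟩
    induction t using TensorProduct.induction_on with
    | zero => simp
    | add a b ha hb => rw [map_add]; exact add_mem ha hb
    | tmul a b =>
      obtain ⟨_, p, hp, rfl⟩ := a
      obtain ⟨_, q, hq, rfl⟩ := b
      refine ⟨_, ⟨rename (e ∘ Sum.inl) p * rename (e ∘ Sum.inr) q,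
        (IsHomogeneous.rename_isHomogeneous hp).mul (IsHomogeneous.rename_isHomogeneous hq), rfl⟩,
        ?_⟩
      change toTensor e A₁ A₂ _ = _
      rw [map_mul, toTensor_rename_inl, toTensor_rename_inr, Algebra.TensorProduct.tmul_mul_tmul,
        one_mul, mul_one]
      rfl

theorem finrank_degreePart_disjointSum :
    Module.finrank K (degreePart (disjointSum e A₁ A₂) (s₁ + s₂))
      = Module.finrank K (degreePart A₁ s₁) * Module.finrank K (degreePart A₂ s₂) := by
  rw [← finrank_range_mapIncl, ← map_tensorEquiv_degreePart e hs₁ hs₂]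
  exact ((tensorEquiv e A₁ A₂).toLinearEquiv.finrank_map_eq _).symm

theorem isTopDegree_disjointSum : IsTopDegree (disjointSum e A₁ A₂) (s₁ + s₂) := by
  refine ⟨fun h => ?_, fun j hj => ?_⟩
  · have h1 := finrank_degreePart_disjointSum e hs₁ hs₂
    rw [h, finrank_bot] at h1
    exact mul_ne_zero (finrank_degreePart_ne_zero hs₁) (finrank_degreePart_ne_zero hs₂) h1.symm
  · rw [eq_bot_iff]
    rintro _ ⟨p, hp, rfl⟩
    rw [Submodule.mem_bot]
    apply (tensorEquiv e A₁ A₂).injective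
    rw [map_zero, ← Submodule.mem_bot K]
    refine Submodule.span_le.2 ?_ (toTensor_mem_span e hp)
    rintro _ ⟨a, b, hab, y, hy, z, hz, rfl⟩
    rcases le_or_gt a s₁ with h | h
    · rw [hs₂.2 b (by omega), Submodule.mem_bot] at hz
      rw [hz, tmul_zero]
      exact zero_mem _
    · rw [hs₁.2 a h, Submodule.mem_bot] at hy
      rw [hy, zero_tmul]
      exact zero_mem _

end DisjointSum

/-! ### Cohen-Macaulay algebras and binomial edge ideals -/

section CohenMacaulay

attribute [local instance] MvPolynomial.gradedAlgebra

variable {K σ : Type*} [Field K] [Fintype σ] [DecidableEq σ]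

/-- A Cohen-Macaulay standard graded algebra has an Artinian reduction by homogeneous elements. -/
theorem IsCohenMacaulay.exists_regularReduction {J : Ideal (MvPolynomial σ K)}
    (h : IsCohenMacaulay J) (hJ : J.IsHomogeneous (homogeneousSubmodule σ K)) :
    ∃ A c E s, RegularReduction J A c E ∧ A.IsHomogeneous (homogeneousSubmodule σ K) ∧
      IsTopDegree A s := by
  obtain ⟨rs, hmem, hreg, hdim⟩ := h
  have hspan : irrelevantIdeal J
      = Ideal.span (Set.range fun v => Ideal.Quotient.mk J (X v)) := by
    rw [irrelevantIdeal, Ideal.map_span, ← Set.range_comp]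
    rfl
  have hdepth := hasKoszulDepth_of_isWeaklyRegular (K := K)
    (fun v => Ideal.Quotient.mk J (X v)) rs (MvPolynomial σ K ⧸ J)
    (fun r hr => hspan ▸ hmem r hr) hreg.toIsWeaklyRegular
  have hne : J ≠ ⊤ := Ideal.Quotient.nontrivial_iff.1 hreg.nontrivial
  -- `hdepth` is about `S / J` as a module over itself; over `S` the Koszul complex is the same.
  obtain ⟨A, c, E, hA, hAh, hAne, hrad⟩ := GradedBetti.exists_regularReduction rs.length hJ hne
    (fun i m hi => hdepth i m hi) hdim.ge
  obtain ⟨s, hs⟩ := exists_isTopDegree hAne hrad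
  exact ⟨A, c, E, s, hA, hAh, hs⟩

end CohenMacaulay

section BinomialEdgeIdeal

attribute [local instance] MvPolynomial.gradedAlgebra

variable (K : Type*) [Field K] {V V₁ V₂ : Type*}

theorem isHomogeneous_binomialEdgeIdeal (G : SimpleGraph V) :
    (binomialEdgeIdeal K G).IsHomogeneous (homogeneousSubmodule (EdgeVar V) K) := by
  refine Ideal.homogeneous_span _ _ ?_
  rintro _ ⟨i, j, -, rfl⟩
  exact ⟨2, ((isHomogeneous_X K _).mul (isHomogeneous_X K _)).sub
    ((isHomogeneous_X K _).mul (isHomogeneous_X K _))⟩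

theorem binomialEdgeIdeal_sum (H₁ : SimpleGraph V₁) (H₂ : SimpleGraph V₂) :
    binomialEdgeIdeal K (H₁ ⊕g H₂)
      = disjointSum (Equiv.sumSumSumComm V₁ V₁ V₂ V₂) (binomialEdgeIdeal K H₁)
          (binomialEdgeIdeal K H₂) := by
  apply le_antisymm
  · refine Ideal.span_le.2 ?_
    rintro _ ⟨i | i, j | j, hij, rfl⟩
    · refine Ideal.mem_sup_left ?_
      have := Ideal.mem_map_of_mem
        (rename (Equiv.sumSumSumComm V₁ V₁ V₂ V₂ ∘ Sum.inl) :
          MvPolynomial (EdgeVar V₁) K →ₐ[K] MvPolynomial (EdgeVar (V₁ ⊕ V₂)) K)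
        (Ideal.subset_span ⟨i, j, hij, rfl⟩ : _ ∈ binomialEdgeIdeal K H₁)
      rw [map_sub, map_mul, map_mul, rename_X, rename_X, rename_X, rename_X] at this
      exact this
    · exact absurd hij (by simp)
    · exact absurd hij (by simp)
    · refine Ideal.mem_sup_right ?_
      have := Ideal.mem_map_of_mem
        (rename (Equiv.sumSumSumComm V₁ V₁ V₂ V₂ ∘ Sum.inr) :
          MvPolynomial (EdgeVar V₂) K →ₐ[K] MvPolynomial (EdgeVar (V₁ ⊕ V₂)) K)
        (Ideal.subset_span ⟨i, j, hij, rfl⟩ : _ ∈ binomialEdgeIdeal K H₂)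
      rw [map_sub, map_mul, map_mul, rename_X, rename_X, rename_X, rename_X] at this
      exact this
  · refine sup_le ?_ ?_
    · refine Ideal.map_le_iff_le_comap.2 (Ideal.span_le.2 ?_)
      rintro _ ⟨i, j, hij, rfl⟩
      refine Ideal.subset_span ⟨Sum.inl i, Sum.inl j, hij, ?_⟩
      simp
    · refine Ideal.map_le_iff_le_comap.2 (Ideal.span_le.2 ?_)
      rintro _ ⟨i, j, hij, rfl⟩
      refine Ideal.subset_span ⟨Sum.inr i, Sum.inr j, hij, ?_⟩
      simp

end BinomialEdgeIdeal

end GradedBetti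

end

theorem mainTheorem10 (K : Type*) [Field K]
    {V₁ V₂ : Type*} [Fintype V₁] [DecidableEq V₁] [Fintype V₂] [DecidableEq V₂]
    (H₁ : SimpleGraph V₁) (H₂ : SimpleGraph V₂)
    (hconn₁ : H₁.Connected) (hconn₂ : H₂.Connected)
    (hCM₁ : GradedBetti.IsCohenMacaulay (binomialEdgeIdeal K H₁))
    (hCM₂ : GradedBetti.IsCohenMacaulay (binomialEdgeIdeal K H₂)) :
    GradedBetti.cmType (binomialEdgeIdeal K (H₁ ⊕g H₂)) =
        GradedBetti.cmType (binomialEdgeIdeal K H₁) *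
          GradedBetti.cmType (binomialEdgeIdeal K H₂) ∧
      GradedBetti.HasUniqueExtremal (binomialEdgeIdeal K H₁) ∧
      GradedBetti.HasUniqueExtremal (binomialEdgeIdeal K H₂) ∧
      GradedBetti.HasUniqueExtremal (binomialEdgeIdeal K (H₁ ⊕g H₂)) ∧
      GradedBetti.uniqueExtremal (binomialEdgeIdeal K (H₁ ⊕g H₂)) =
        GradedBetti.uniqueExtremal (binomialEdgeIdeal K H₁) *
          GradedBetti.uniqueExtremal (binomialEdgeIdeal K H₂) := by
  have hh₁ := GradedBetti.isHomogeneous_binomialEdgeIdeal K H₁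
  have hh₂ := GradedBetti.isHomogeneous_binomialEdgeIdeal K H₂
  obtain ⟨A₁, c₁, E₁, s₁, hr₁, hA₁, hs₁⟩ := hCM₁.exists_regularReduction hh₁
  obtain ⟨A₂, c₂, E₂, s₂, hr₂, hA₂, hs₂⟩ := hCM₂.exists_regularReduction hh₂
  obtain ⟨p₁, r₁, hC₁, htype₁, hext₁⟩ := hr₁.exists_hasCorner hh₁ hA₁ hs₁
  obtain ⟨p₂, r₂, hC₂, htype₂, hext₂⟩ := hr₂.exists_hasCorner hh₂ hA₂ hs₂
  have hr := hr₁.disjointSum (Equiv.sumSumSumComm V₁ V₁ V₂ V₂) hr₂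
  obtain ⟨p, r, hC, htype, hext⟩ := hr.exists_hasCorner
    (GradedBetti.isHomogeneous_disjointSum _ hh₁ hh₂)
    (GradedBetti.isHomogeneous_disjointSum _ hA₁ hA₂)
    (GradedBetti.isTopDegree_disjointSum _ hs₁ hs₂)
  rw [GradedBetti.binomialEdgeIdeal_sum]
  refine ⟨?_, hC₁.hasUniqueExtremal, hC₂.hasUniqueExtremal, hC.hasUniqueExtremal, ?_⟩
  · rw [htype, htype₁, htype₂, GradedBetti.finrank_socle_disjointSum]
  · rw [hC.uniqueExtremal_eq, hC₁.uniqueExtremal_eq, hC₂.uniqueExtremal_eq, hext, hext₁, hext₂,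
      GradedBetti.finrank_degreePart_disjointSum _ hs₁ hs₂]
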